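/- Let $q_1,\dots,q_N:\mathbb{R}^p\to\mathbb{R}$ (for a network $\Phi$ and data $(x_i,y_i)$, $q_i(w)=y_i\Phi(w,x_i)$), let $\ell=e^{-f}$ be either the exponential loss, $f(x)=x$, or the logistic loss, $f(x)=-\log\log(1+e^{-x})$, and let $\mathcal{L}(w)=\sum_{i=1}^N e^{-f(q_i(w))}$. Write $\partial^\circ$ for the Clarke subdifferential, $\odot$ and powers of vectors for element-wise operations, and $\|\cdot\|$ for the Euclidean norm. Assume: (I) each $q_i$ is locally Lipschitz and admits a chain rule: for every absolutely continuous arc $z$, for almost every $t$, $\frac{d}{dt}q_i(z(t))=\langle\xi,z'(t)\rangle$ for all $\xi\in\partial^\circ q_i(z(t))$; (II) there is $L>0$ such that $q_i(\alpha w)=\alpha^L q_i(w)$ for all $i$, all $w$ and all $\alpha>0$. Let $\varepsilon>0$ and let $w:[0,\infty)\to\mathbb{R}^p$ be an AdaGrad flow: $w$ is absolutely continuous on compact intervals and, for almost every $t$, $$\frac{dw(t)}{dt}=-h(t)\odot g(t),\qquad g(t)\in\partial^\circ\mathcal{L}(w(t)),\qquad h(t)^{-1}=\sqrt{\varepsilon\mathbf{1}_p+\int_0^t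 g(\tau)^2\,d\tau}.$$ Assume further: (III) there is a time $t_0\ge 0$ with $f^{-1}\big(\log\frac{1}{\mathcal{L}(w(t_0))}\big)>0$. Then $h_\infty=\lim_{t\to\infty}h(t)$ exists and all its components are positive, and every limit point, as $t\to\infty$, of $w(t)/\|w(t)\|$ is a positive multiple of a KKT point of the problem $$\min_{w}\ \tfrac12\big\|h_\infty^{-1/2}\odot w\big\|\quad\text{subject to } q_i(w)\ge 1\text{ for all } i\in\{1,\dots,N\}.$$ Here $x$ is a KKT point of $\min F$ subject to $G_i\le 0$ ($i=1,\dots,N$) if $G_i(x)\le 0$ for all $i$ and there are $\lambda_i\ge 0$, $k\in\partial^\circ F(x)$ and $\eta_i\in\partial^\circ G_i(x)$ with $k+\sum_i\lambda_i\eta_i=0$ and $\lambda_iG_i(x)=0$ for all $i$. -/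

import Mathlib

open Filter Topology MeasureTheory

noncomputable section

/-- Parameter space `ℝᵖ` with its Euclidean norm. -/
abbrev Param (p : ℕ) : Type := EuclideanSpace ℝ (Fin p)

/-- Element-wise product of two vectors. -/
def hadamard {p : ℕ} (u v : Param p) : Param p :=
  WithLp.toLp 2 fun j => u j * v j

/-- Element-wise real power of a vector. -/
def hadamardPow {p : ℕ} (u : Param p) (r : ℝ) : Param p :=
  WithLp.toLp 2 fun j => u j ^ r

/-- Clarke's generalized directional derivative
`F°(x; d) = limsup_{y → x, s ↓ 0} (F (y + s d) - F y) / s`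
(a finite number whenever `F` is Lipschitz near `x`). -/
def clarkeDirDeriv {p : ℕ} (F : Param p → ℝ) (x d : Param p) : ℝ :=
  limsup (fun ys : Param p × ℝ => (F (ys.1 + ys.2 • d) - F ys.1) / ys.2)
    (𝓝 x ×ˢ 𝓝[>] (0 : ℝ))

/-- The Clarke subdifferential of a locally Lipschitz function. -/
def clarkeSubdiff {p : ℕ} (F : Param p → ℝ) (x : Param p) : Set (Param p) :=
  {ξ | ∀ d : Param p, inner ℝ ξ d ≤ clarkeDirDeriv F x d}

/-- `F` admits a chain rule: along every absolutely continuous arc `z`, for almost every time,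
`(F ∘ z)' = ⟨ξ, z'⟩` for all Clarke subgradients `ξ` of `F` at the current point. -/
def AdmitsChainRule {p : ℕ} (F : Param p → ℝ) : Prop :=
  ∀ (z : ℝ → Param p) (a b : ℝ), AbsolutelyContinuousOnInterval z a b →
    ∀ᵐ t : ℝ, t ∈ Set.Ioo a b → ∀ ξ ∈ clarkeSubdiff F (z t),
      HasDerivAt (fun s => F (z s)) (inner ℝ ξ (deriv z t)) t

/-- The exponential loss `ℓ(x) = e^{-x}` is `e^{-f(x)}` with this `f`. -/
def expLossExponent (x : ℝ) : ℝ := x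

/-- The logistic loss `ℓ(x) = log (1 + e^{-x})` is `e^{-f(x)}` with this `f`. -/
def logisticLossExponent (x : ℝ) : ℝ := -Real.log (Real.log (1 + Real.exp (-x)))

/-- The empirical loss `∑ᵢ e^{-f(qᵢ(w))}`, where `qᵢ` is the margin on the `i`-th sample. -/
def empiricalLoss {p N : ℕ} (f : ℝ → ℝ) (q : Fin N → Param p → ℝ) (w : Param p) : ℝ :=
  ∑ i, Real.exp (-f (q i w))

/-- The AdaGrad conditioner `h(t)`, `h(t)⁻¹ = √(ε 1 + ∫₀ᵗ g(τ)² dτ)` (element-wise), where `g(τ)`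
is the subgradient used at time `τ`. -/
def adagradConditioner {p : ℕ} (ε : ℝ) (g : ℝ → Param p) (t : ℝ) : Param p :=
  WithLp.toLp 2 fun j => (Real.sqrt (ε + ∫ τ in (0 : ℝ)..t, (g τ j) ^ 2))⁻¹

/-- `w : [0, ∞) → ℝᵖ` is an AdaGrad flow for the loss `F`, with `g(t)` the subgradient of `F` at
`w(t)` that occurs in the flow: `w` is a locally absolutely continuous arc and, for almost every
`t > 0`, `g(t) ∈ ∂°F(w(t))` and `w'(t) = - h(t) ⊙ g(t)`. -/
structure IsAdaGradFlow {p : ℕ} (F : Param p → ℝ) (ε : ℝ) (w g : ℝ → Param p) : Prop where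
  absolutelyContinuous : ∀ T : ℝ, 0 ≤ T → AbsolutelyContinuousOnInterval w 0 T
  integrable_sq : ∀ T : ℝ, 0 ≤ T → ∀ j, IntervalIntegrable (fun τ => (g τ j) ^ 2) volume 0 T
  subgradient : ∀ᵐ t : ℝ, 0 < t → g t ∈ clarkeSubdiff F (w t)
  flow : ∀ᵐ t : ℝ, 0 < t → HasDerivAt w (-hadamard (adagradConditioner ε g t) (g t)) t

/-- `x` is a KKT point of `min F(x)` subject to `Gᵢ(x) ≤ 0` for all `i`. -/
def IsKKTPoint {p N : ℕ} (F : Param p → ℝ) (G : Fin N → Param p → ℝ) (x : Param p) : Prop :=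
  (∀ i, G i x ≤ 0) ∧
    ∃ (lam : Fin N → ℝ) (k : Param p) (η : Fin N → Param p),
      (∀ i, 0 ≤ lam i) ∧ k ∈ clarkeSubdiff F x ∧ (∀ i, η i ∈ clarkeSubdiff (G i) x) ∧
      k + ∑ i, lam i • η i = 0 ∧ ∀ i, lam i * G i x = 0

end

/-! ### Calculus of Clarke subgradients. -/

section ClarkeCalculus

variable {p : ℕ}

/-! Write `S_j = h_j⁻²`, `Λ` for the loss, `A = ∑ h_j g_j²`, `ν = -⟨w, g⟩`, `R = ‖h^{-1/2} ⊙ w‖²`,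
`ρ = ½ log R` and `H = ¼ ∑ log S_j`. Along the flow `Λ' = -A`, while `(√S_j)' = h_j g_j² / 2`, so `Λ
+ 2 ∑ √S_j` is conserved. As `Λ > 0`, the increasing `S_j` stay bounded and `h` has a positive limit
(`exists_sqrt_secondMoment_le`).

In the moving metric `ν / R ≤ ρ' ≤ ν / R + H'`, and `H` is bounded. Hence `Γ = log ψ(Λ) - L ρ + L
H`, with `ψ` inverse to the loss function, satisfies `Γ' ≥ L (A / ν - ν / R)`, which is nonnegative
by Cauchy–Schwarz, `ν² ≤ A R` (`logSurrogateMargin_mono`). Consequently the margins grow like `‖w‖ ^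
L`, the loss tends to zero and `ρ → ∞`.

`Γ` is also bounded above, so the Cauchy–Schwarz defect must become small somewhere in every late
window on which `ρ` grows by a fixed amount. The direction `w / ‖w‖` moves at most by a multiple of
that growth, so such almost aligned times exist near any limit direction (`exists_aligned_time`).
There the normalised loss weights are approximate multipliers. Compactness and the closed graph of
the Clarke subdifferential yield exact ones, with stationarity coming from the equality case of
Cauchy–Schwarz and complementary slackness from the exponential tail (`exists_limit_multipliers`).
Rescaling the direction until its smallest margin is 1 gives the KKT point
(`exists_isKKTPoint_of_multipliers`).

The nonsmooth inputs are Euler's identity (`inner_eq_of_mem_clarkeSubdiff`) and the splitting of a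
subgradient of the loss into subgradients of the margins (`exists_of_mem_clarkeSubdiff_sum_comp`).
-/

theorem tendsto_add_smul_clarke (x d : Param p) :
    Tendsto (fun ys : Param p × ℝ => ys.1 + ys.2 • d) (𝓝 x ×ˢ 𝓝[>] (0 : ℝ)) (𝓝 x) := by
  have : Tendsto (fun ys : Param p × ℝ => ys.1 + ys.2 • d) (𝓝 x ×ˢ 𝓝 (0 : ℝ))
      (𝓝 (x + (0 : ℝ) • d)) := by
    rw [← nhds_prod_eq]
    exact Continuous.tendsto (by fun_prop) (x, (0 : ℝ))
  rw [zero_smul, add_zero] at this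
  exact this.mono_left (Filter.prod_mono le_rfl nhdsWithin_le_nhds)

/-- Moving the base point from `y` to `y + s d` is harmless in Clarke's limsup; this substitution
reverses directions and concatenates increments. -/
theorem tendsto_shift_clarke (x d : Param p) :
    Tendsto (fun ys : Param p × ℝ => (ys.1 + ys.2 • d, ys.2))
      (𝓝 x ×ˢ 𝓝[>] (0 : ℝ)) (𝓝 x ×ˢ 𝓝[>] (0 : ℝ)) :=
  (tendsto_add_smul_clarke x d).prodMk tendsto_snd

theorem eventually_snd_pos_clarke (x : Param p) :
    ∀ᶠ ys : Param p × ℝ in 𝓝 x ×ˢ 𝓝[>] (0 : ℝ), 0 < ys.2 :=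
  tendsto_snd.eventually self_mem_nhdsWithin

/-- The difference quotients in Clarke's directional derivative are bounded by the Lipschitz
constant. -/
theorem LipschitzOnWith.eventually_abs_quotient_le {F : Param p → ℝ} {K : NNReal}
    {U : Set (Param p)} {x : Param p} (hK : LipschitzOnWith K F U) (hU : U ∈ 𝓝 x) (d : Param p) :
    ∀ᶠ ys : Param p × ℝ in 𝓝 x ×ˢ 𝓝[>] (0 : ℝ),
      |(F (ys.1 + ys.2 • d) - F ys.1) / ys.2| ≤ K * ‖d‖ := by
  have h1 := tendsto_add_smul_clarke x d
  have h2 : ∀ᶠ ys : Param p × ℝ in 𝓝 x ×ˢ 𝓝[>] (0 : ℝ), ys.1 ∈ U :=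
    tendsto_fst.eventually hU
  have h3 := eventually_snd_pos_clarke x
  filter_upwards [h1.eventually hU, h2, h3] with ys hy1 hy2 hs
  rw [abs_div, abs_of_pos hs, div_le_iff₀ hs]
  have := hK.dist_le_mul _ hy1 _ hy2
  rw [Real.dist_eq, dist_eq_norm, add_sub_cancel_left, norm_smul, Real.norm_eq_abs,
    abs_of_pos hs] at this
  linarith

theorem LocallyLipschitz.exists_eventually_abs_quotient_le {F : Param p → ℝ}
    (hF : LocallyLipschitz F) (x d : Param p) :
    ∃ C, ∀ᶠ ys : Param p × ℝ in 𝓝 x ×ˢ 𝓝[>] (0 : ℝ),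
      |(F (ys.1 + ys.2 • d) - F ys.1) / ys.2| ≤ C := by
  obtain ⟨K, U, hU, hK⟩ := hF x
  exact ⟨_, hK.eventually_abs_quotient_le hU d⟩

theorem LocallyLipschitz.isBoundedUnder_quotient {F : Param p → ℝ}
    (hF : LocallyLipschitz F) (x d : Param p) :
    IsBoundedUnder (· ≤ ·) (𝓝 x ×ˢ 𝓝[>] (0 : ℝ))
      (fun ys : Param p × ℝ => (F (ys.1 + ys.2 • d) - F ys.1) / ys.2) := by
  obtain ⟨C, hC⟩ := hF.exists_eventually_abs_quotient_le x d
  exact ⟨C, eventually_map.2 (hC.mono fun ys h => (abs_le.1 h).2)⟩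

theorem LocallyLipschitz.isCoboundedUnder_quotient {F : Param p → ℝ}
    (hF : LocallyLipschitz F) (x d : Param p) :
    IsCoboundedUnder (· ≤ ·) (𝓝 x ×ˢ 𝓝[>] (0 : ℝ))
      (fun ys : Param p × ℝ => (F (ys.1 + ys.2 • d) - F ys.1) / ys.2) := by
  obtain ⟨C, hC⟩ := hF.exists_eventually_abs_quotient_le x d
  refine IsBoundedUnder.isCoboundedUnder_le ?_
  exact ⟨-C, eventually_map.2 (hC.mono fun ys h => (abs_le.1 h).1)⟩

theorem LocallyLipschitz.eventually_quotient_lt {F : Param p → ℝ} (hF : LocallyLipschitz F)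
    {x d : Param p} {c : ℝ} (h : clarkeDirDeriv F x d < c) :
    ∀ᶠ ys : Param p × ℝ in 𝓝 x ×ˢ 𝓝[>] (0 : ℝ),
      (F (ys.1 + ys.2 • d) - F ys.1) / ys.2 < c :=
  eventually_lt_of_limsup_lt h (hF.isBoundedUnder_quotient x d)

theorem LocallyLipschitz.clarkeDirDeriv_le {F : Param p → ℝ} (hF : LocallyLipschitz F)
    {x d : Param p} {c : ℝ}
    (h : ∀ᶠ ys : Param p × ℝ in 𝓝 x ×ˢ 𝓝[>] (0 : ℝ),
      (F (ys.1 + ys.2 • d) - F ys.1) / ys.2 ≤ c) :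
    clarkeDirDeriv F x d ≤ c :=
  limsup_le_of_le (hF.isCoboundedUnder_quotient x d) h

theorem mem_clarkeSubdiff_of_forall_lt {F : Param p → ℝ} {x ξ : Param p}
    (h : ∀ d c, clarkeDirDeriv F x d < c → inner ℝ ξ d ≤ c) : ξ ∈ clarkeSubdiff F x :=
  fun d => le_of_forall_gt_imp_ge_of_dense fun c hc => h d c hc

/-- Clarke subgradients are bounded by a local Lipschitz constant. -/
theorem norm_le_of_mem_clarkeSubdiff {F : Param p → ℝ} (hF : LocallyLipschitz F) {K : NNReal}
    {U : Set (Param p)} {x ξ : Param p} (hK : LipschitzOnWith K F U) (hU : U ∈ 𝓝 x)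
    (hξ : ξ ∈ clarkeSubdiff F x) : ‖ξ‖ ≤ K := by
  -- Testing the subgradient on itself gives `‖ξ‖² ≤ K ‖ξ‖`.
  have h1 : clarkeDirDeriv F x ξ ≤ K * ‖ξ‖ :=
    hF.clarkeDirDeriv_le ((hK.eventually_abs_quotient_le hU ξ).mono fun ys h => (abs_le.1 h).2)
  have h2 := (hξ ξ).trans h1
  rw [real_inner_self_eq_norm_sq] at h2
  by_contra! h
  have : (0 : ℝ) ≤ K := K.2
  nlinarith [norm_nonneg ξ]

/-- The graph of the Clarke subdifferential is closed. -/
theorem mem_clarkeSubdiff_of_tendsto {F : Param p → ℝ} (hF : LocallyLipschitz F) {ι : Type*}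
    {l : Filter ι} [l.NeBot] {x ξ : ι → Param p} {x₀ ξ₀ : Param p} (hx : Tendsto x l (𝓝 x₀))
    (hξ : Tendsto ξ l (𝓝 ξ₀)) (h : ∀ᶠ k in l, ξ k ∈ clarkeSubdiff F (x k)) :
    ξ₀ ∈ clarkeSubdiff F x₀ := by
  refine mem_clarkeSubdiff_of_forall_lt fun d c hc => ?_
  have h1 := hF.eventually_quotient_lt hc
  -- Upper semicontinuity in the base point: a quotient bound valid on a box around `x₀` is valid
  -- around every nearby `y`.
  obtain ⟨pa, hpa, pb, hpb, hab⟩ := eventually_prod_iff.1 h1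
  have h2 : ∀ᶠ y in 𝓝 x₀, clarkeDirDeriv F y d ≤ c := by
    filter_upwards [eventually_eventually_nhds.2 hpa] with y hy
    refine hF.clarkeDirDeriv_le ?_
    exact (hy.prod_mk hpb).mono fun ys h => (hab h.1 h.2).le
  refine le_of_tendsto (hξ.inner tendsto_const_nhds) ?_
  filter_upwards [h, hx.eventually h2] with k hk hk2
  exact (hk d).trans hk2

/-- Reading an increment backwards from its endpoint shows `F°(x; -d) ≤ (c₀ - F)°(x; d)`. -/
theorem neg_mem_clarkeSubdiff_const_sub {F : Param p → ℝ} (hF : LocallyLipschitz F)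
    {x ξ : Param p} (c₀ : ℝ) (hξ : ξ ∈ clarkeSubdiff F x) :
    -ξ ∈ clarkeSubdiff (fun y => c₀ - F y) x := by
  have hF' : LocallyLipschitz (fun y => c₀ - F y) := by
    intro y
    obtain ⟨K, U, hU, hK⟩ := hF y
    refine ⟨K, U, hU, LipschitzOnWith.of_dist_le_mul fun a ha b hb => ?_⟩
    rw [dist_sub_left]
    exact hK.dist_le_mul a ha b hb
  refine mem_clarkeSubdiff_of_forall_lt fun d c hc => ?_
  have h1 := hF'.eventually_quotient_lt hc
  have hmap := tendsto_shift_clarke x (-d)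
  have h2 : clarkeDirDeriv F x (-d) ≤ c := by
    refine hF.clarkeDirDeriv_le ((hmap.eventually h1).mono fun ys h => ?_)
    simp only [smul_neg, neg_add_cancel_right] at h ⊢
    refine le_of_eq_of_le ?_ h.le
    ring
  have := (hξ (-d)).trans h2
  simpa using this

/-- Clarke subgradients of a positively homogeneous function scale with the base point. -/
theorem rpow_smul_mem_clarkeSubdiff {F : Param p → ℝ} (hF : LocallyLipschitz F) {L : ℝ}
    (hom : ∀ α : ℝ, 0 < α → ∀ x, F (α • x) = α ^ L * F x) {x ξ : Param p}
    (hξ : ξ ∈ clarkeSubdiff F x) {α : ℝ} (hα : 0 < α) :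
    α ^ (L - 1) • ξ ∈ clarkeSubdiff F (α • x) := by
  refine mem_clarkeSubdiff_of_forall_lt fun d c hc => ?_
  have h1 := hF.eventually_quotient_lt hc
  -- Dilating both base point and step by `α` multiplies the difference quotient by `α ^ (L - 1)`.
  have hmap : Tendsto (fun ys : Param p × ℝ => (α • ys.1, α * ys.2))
      (𝓝 x ×ˢ 𝓝[>] (0 : ℝ)) (𝓝 (α • x) ×ˢ 𝓝[>] (0 : ℝ)) := by
    refine Tendsto.prodMk (tendsto_fst.const_smul α) ?_
    refine tendsto_nhdsWithin_iff.2 ⟨?_, ?_⟩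
    · have : Tendsto (fun ys : Param p × ℝ => α * ys.2) (𝓝 x ×ˢ 𝓝[>] (0 : ℝ)) (𝓝 (α * 0)) :=
        (tendsto_snd.mono_right nhdsWithin_le_nhds).const_mul α
      simpa using this
    · have h3 : ∀ᶠ ys : Param p × ℝ in 𝓝 x ×ˢ 𝓝[>] (0 : ℝ), 0 < ys.2 :=
        tendsto_snd.eventually self_mem_nhdsWithin
      exact h3.mono fun ys h => mul_pos hα h
  have hpos : 0 < α ^ (L - 1) := Real.rpow_pos_of_pos hα _
  have h2 : clarkeDirDeriv F x d ≤ c / α ^ (L - 1) := by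
    refine hF.clarkeDirDeriv_le ?_
    have h3 := eventually_snd_pos_clarke x
    filter_upwards [hmap.eventually h1, h3] with ys h hs
    simp only [mul_smul, ← smul_add, hom α hα] at h
    rw [le_div_iff₀ hpos]
    refine le_of_eq_of_le ?_ h.le
    rw [Real.rpow_sub_one hα.ne']
    field_simp
  have h4 := (hξ d).trans h2
  rw [le_div_iff₀ hpos] at h4
  rw [real_inner_smul_left]
  linarith

/-- Euler's identity for Clarke subgradients of a homogeneous function with a chain rule. -/
theorem inner_eq_of_mem_clarkeSubdiff {F : Param p → ℝ} (hF : LocallyLipschitz F)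
    (hC : AdmitsChainRule F) {L : ℝ}
    (hom : ∀ α : ℝ, 0 < α → ∀ x, F (α • x) = α ^ L * F x) {x ξ : Param p}
    (hξ : ξ ∈ clarkeSubdiff F x) : inner ℝ ξ x = L * F x := by
  have hz : ∀ t : ℝ, HasDerivAt (fun s : ℝ => s • x) x t := fun t => by
    simpa using (hasDerivAt_id t).smul_const x
  have hac : AbsolutelyContinuousOnInterval (fun s : ℝ => s • x) 1 2 := by
    apply ContDiffOn.absolutelyContinuousOnInterval
    fun_prop
  -- The chain rule along the ray may fail at time 1, so it is used at some `t` in `(1, 2)`, to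
  -- which `ξ` is carried by homogeneity.
  have hne : ∃ t ∈ Set.Ioo (1 : ℝ) 2, ∀ ξ ∈ clarkeSubdiff F (t • x),
      HasDerivAt (fun s : ℝ => F (s • x)) (inner ℝ ξ (deriv (fun s : ℝ => s • x) t)) t := by
    by_contra! hcon
    have h0 := hC _ _ _ hac
    have h1 : volume (Set.Ioo (1 : ℝ) 2) = 0 := by
      refine measure_mono_null ?_ (ae_iff.1 h0)
      intro t ht
      obtain ⟨ξ, h2, h3⟩ := hcon t ht
      exact fun h4 => h3 (h4 ht ξ h2)
    rw [Real.volume_Ioo] at h1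
    norm_num at h1
  obtain ⟨t, ht, h⟩ := hne
  have ht0 : 0 < t := by linarith [ht.1]
  have h1 := h _ (rpow_smul_mem_clarkeSubdiff hF hom hξ ht0)
  rw [(hz t).deriv] at h1
  have h2 : HasDerivAt (fun s : ℝ => F (s • x)) (L * t ^ (L - 1) * F x) t := by
    have h3 : HasDerivAt (fun s : ℝ => s ^ L * F x) (L * t ^ (L - 1) * F x) t :=
      (Real.hasDerivAt_rpow_const (Or.inl ht0.ne')).mul_const _
    refine h3.congr_of_eventuallyEq ?_
    filter_upwards [lt_mem_nhds ht0] with s hs using hom s hs x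
  have h5 := h1.unique h2
  rw [real_inner_smul_left] at h5
  have hpos : 0 < t ^ (L - 1) := Real.rpow_pos_of_pos ht0 _
  have : t ^ (L - 1) * (inner ℝ ξ x) = t ^ (L - 1) * (L * F x) := by rw [h5]; ring
  exact mul_left_cancel₀ hpos.ne' this

theorem clarkeDirDeriv_smul_le {F : Param p → ℝ} (hF : LocallyLipschitz F) (x d : Param p)
    {c : ℝ} (hc : 0 < c) : clarkeDirDeriv F x (c • d) ≤ c * clarkeDirDeriv F x d := by
  refine le_of_forall_gt_imp_ge_of_dense fun b hb => ?_
  have hb' : clarkeDirDeriv F x d < b / c := by rwa [lt_div_iff₀' hc]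
  have hmap : Tendsto (fun ys : Param p × ℝ => (ys.1, c * ys.2))
      (𝓝 x ×ˢ 𝓝[>] (0 : ℝ)) (𝓝 x ×ˢ 𝓝[>] (0 : ℝ)) := by
    refine tendsto_fst.prodMk (tendsto_nhdsWithin_iff.2 ⟨?_, ?_⟩)
    · have : Tendsto (fun ys : Param p × ℝ => c * ys.2) (𝓝 x ×ˢ 𝓝[>] (0 : ℝ)) (𝓝 (c * 0)) :=
        (tendsto_snd.mono_right nhdsWithin_le_nhds).const_mul c
      simpa using this
    · exact (eventually_snd_pos_clarke x).mono fun ys h => mul_pos hc h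
  refine hF.clarkeDirDeriv_le ?_
  filter_upwards [hmap.eventually (hF.eventually_quotient_lt hb'), eventually_snd_pos_clarke x]
    with ys h hs
  rw [lt_div_iff₀ hc] at h
  simp only [smul_smul, mul_comm ys.2 c] at h ⊢
  refine le_of_eq_of_le ?_ h.le
  field_simp

theorem clarkeDirDeriv_smul {F : Param p → ℝ} (hF : LocallyLipschitz F) (x d : Param p)
    {c : ℝ} (hc : 0 < c) : clarkeDirDeriv F x (c • d) = c * clarkeDirDeriv F x d := by
  refine le_antisymm (clarkeDirDeriv_smul_le hF x d hc) ?_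
  have h := clarkeDirDeriv_smul_le hF x (c • d) (inv_pos.2 hc)
  rw [smul_smul, inv_mul_cancel₀ hc.ne', one_smul] at h
  calc c * clarkeDirDeriv F x d ≤ c * (c⁻¹ * clarkeDirDeriv F x (c • d)) :=
        mul_le_mul_of_nonneg_left h hc.le
    _ = clarkeDirDeriv F x (c • d) := by field_simp

/-- The increment along `d + e` is the one along `d` from `y` plus the one along `e` from `y + s d`.
With positive homogeneity this gives the sublinearity needed for Hahn–Banach. -/
theorem clarkeDirDeriv_add_le {F : Param p → ℝ} (hF : LocallyLipschitz F) (x d e : Param p) :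
    clarkeDirDeriv F x (d + e) ≤ clarkeDirDeriv F x d + clarkeDirDeriv F x e := by
  refine le_of_forall_pos_le_add fun δ hδ => ?_
  have h1 := hF.eventually_quotient_lt (show clarkeDirDeriv F x d < clarkeDirDeriv F x d + δ / 2
    by linarith)
  have h2 := (tendsto_shift_clarke x d).eventually (hF.eventually_quotient_lt
    (show clarkeDirDeriv F x e < clarkeDirDeriv F x e + δ / 2 by linarith))
  refine hF.clarkeDirDeriv_le ?_
  filter_upwards [h1, h2] with ys h1 h2
  have : (F (ys.1 + ys.2 • (d + e)) - F ys.1) / ys.2 =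
      (F (ys.1 + ys.2 • d) - F ys.1) / ys.2 +
        (F (ys.1 + ys.2 • d + ys.2 • e) - F (ys.1 + ys.2 • d)) / ys.2 := by
    rw [smul_add, add_assoc]
    ring
  rw [this]
  linarith

/-- A linear form dominated by a sum of sublinear functions is a sum of linear forms dominated by
the summands. -/
theorem exists_sum_of_le_sum_sublinear {E ι : Type*} [AddCommGroup E] [Module ℝ E] [Fintype ι]
    [Nonempty ι] (φ : E →ₗ[ℝ] ℝ) (P : ι → E → ℝ)
    (hP : ∀ i (c : ℝ), 0 < c → ∀ x, P i (c • x) = c * P i x)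
    (hadd : ∀ i x y, P i (x + y) ≤ P i x + P i y) (hφ : ∀ x, φ x ≤ ∑ i, P i x) :
    ∃ Φ : ι → E →ₗ[ℝ] ℝ, (∀ i x, Φ i x ≤ P i x) ∧ ∀ x, φ x = ∑ i, Φ i x := by
  classical
  obtain ⟨i₀⟩ := ‹Nonempty ι›
  -- Hahn–Banach on the product space: the form, placed on the diagonal, is dominated by `∑ P i (x
  -- i)`, and the extension splits along coordinates.
  let diag : E →ₗ[ℝ] (ι → E) := LinearMap.pi fun _ => LinearMap.id
  let f : (ι → E) →ₗ.[ℝ] ℝ :=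
    ⟨LinearMap.range diag, (φ ∘ₗ LinearMap.proj i₀).domRestrict _⟩
  obtain ⟨G, hG1, hG2⟩ := exists_extension_of_le_sublinear f (fun x => ∑ i, P i (x i))
    (fun c hc x => by simp [hP _ c hc, Finset.mul_sum])
    (fun x y => by
      rw [← Finset.sum_add_distrib]
      exact Finset.sum_le_sum fun i _ => hadd i _ _)
    (by
      rintro ⟨x, y, rfl⟩
      exact hφ y)
  have hP0 : ∀ i, P i 0 = 0 := fun i => by
    have := hP i 2 (by norm_num) 0
    rw [smul_zero] at this
    linarith
  refine ⟨fun i => G ∘ₗ LinearMap.single ℝ (fun _ => E) i, fun i x => ?_, fun x => ?_⟩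
  · refine (hG2 _).trans ?_
    rw [Finset.sum_eq_single i]
    · simp
    · intro j _ hj
      simp [Pi.single_eq_of_ne hj, hP0]
    · simp
  · have h1 := hG1 ⟨diag x, x, rfl⟩
    have h2 : diag x = ∑ i, Pi.single i x := by
      rw [Finset.univ_sum_single (fun _ : ι => x)]
      rfl
    have h3 : G (diag x) = φ x := h1
    rw [← h3, h2, map_sum]
    rfl

/-- Since `ℓ` decreases with slope `-a`, an increment of `ℓ ∘ F` along `d` is `a` times the reversed
increment of `F`, up to an error that strict differentiability and the Lipschitz bound make small.
-/
theorem HasStrictDerivAt.eventually_quotient_comp_le {F : Param p → ℝ} (hF : LocallyLipschitz F)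
    {ℓ : ℝ → ℝ} {a : ℝ} {x : Param p} (hℓ : HasStrictDerivAt ℓ (-a) (F x)) (ha : 0 < a)
    (d : Param p) {c : ℝ} (hc : a * clarkeDirDeriv F x (-d) < c) :
    ∀ᶠ ys : Param p × ℝ in 𝓝 x ×ˢ 𝓝[>] (0 : ℝ),
      (ℓ (F (ys.1 + ys.2 • d)) - ℓ (F ys.1)) / ys.2 ≤ c := by
  obtain ⟨C, hC⟩ := hF.exists_eventually_abs_quotient_le x d
  obtain ⟨c', hc1, hc2⟩ := exists_between hc
  have hc3 : clarkeDirDeriv F x (-d) < c' / a := by rwa [lt_div_iff₀' ha]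
  have h1 := (tendsto_shift_clarke x d).eventually (hF.eventually_quotient_lt hc3)
  obtain ⟨η, hη, hηC⟩ : ∃ η > 0, η * C ≤ c - c' := by
    refine ⟨(c - c') / (|C| + 1), by have := sub_pos.2 hc2; positivity, ?_⟩
    rw [div_mul_eq_mul_div, div_le_iff₀ (by positivity)]
    exact mul_le_mul_of_nonneg_left (by linarith [le_abs_self C]) (by linarith)
  have h2 := (hℓ.hasStrictFDerivAt.isLittleO).bound hη
  have hcont : Tendsto (fun ys : Param p × ℝ => (F (ys.1 + ys.2 • d), F ys.1))
      (𝓝 x ×ˢ 𝓝[>] (0 : ℝ)) (𝓝 (F x, F x)) := by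
    rw [nhds_prod_eq]
    exact ((hF.continuous.tendsto x).comp (tendsto_add_smul_clarke x d)).prodMk
      ((hF.continuous.tendsto x).comp tendsto_fst)
  filter_upwards [hC, h1, hcont.eventually h2, eventually_snd_pos_clarke x] with ys hq h1 h2 hs
  simp only [smul_neg, add_neg_cancel_right] at h1
  set u := F (ys.1 + ys.2 • d)
  set v := F ys.1
  rw [abs_div, abs_of_pos hs, div_le_iff₀ hs] at hq
  rw [div_lt_div_iff₀ hs ha] at h1
  rw [div_le_iff₀ hs]
  simp only [Real.norm_eq_abs, ContinuousLinearMap.toSpanSingleton_apply, smul_eq_mul] at h2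
  have h3 := (abs_le.1 h2).2
  have h4 : η * |u - v| ≤ η * (C * ys.2) := mul_le_mul_of_nonneg_left hq hη.le
  have h5 : η * C * ys.2 ≤ (c - c') * ys.2 := mul_le_mul_of_nonneg_right hηC hs.le
  nlinarith

/-- Sum and chain rule for the Clarke subdifferential of `∑ᵢ ℓ ∘ qᵢ` with `ℓ` decreasing. -/
theorem exists_of_mem_clarkeSubdiff_sum_comp {N : ℕ} [Nonempty (Fin N)]
    {q : Fin N → Param p → ℝ} (hq : ∀ i, LocallyLipschitz (q i)) {ℓ a : ℝ → ℝ}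
    (hℓ : ∀ x, HasStrictDerivAt ℓ (-a x) x) (ha : ∀ x, 0 < a x) {x g : Param p}
    (hg : g ∈ clarkeSubdiff (fun y => ∑ i, ℓ (q i y)) x) :
    ∃ ξ : Fin N → Param p, (∀ i, ξ i ∈ clarkeSubdiff (q i) x) ∧
      g = -∑ i, a (q i x) • ξ i := by
  have hℓL : LocallyLipschitz ℓ := fun y => by
    obtain ⟨K, s, hs, hK⟩ := (hℓ y).hasStrictFDerivAt.exists_lipschitzOnWith
    exact ⟨K, s, hs, hK⟩
  have hsum : ∀ s : Finset (Fin N), LocallyLipschitz (fun y => ∑ i ∈ s, ℓ (q i y)) := by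
    intro s
    induction s using Finset.induction_on with
    | empty => simpa using LocallyLipschitz.const (0 : ℝ)
    | insert i s hi ih =>
      simp only [Finset.sum_insert hi]
      exact (hℓL.comp (hq i)).add ih
  have key : ∀ d, inner ℝ g d ≤ ∑ i, a (q i x) * clarkeDirDeriv (q i) x (-d) := by
    intro d
    refine le_of_forall_pos_le_add fun δ hδ => (hg d).trans ?_
    have hN : (0 : ℝ) < N := by
      obtain ⟨i⟩ := ‹Nonempty (Fin N)›
      exact_mod_cast i.pos
    refine (hsum Finset.univ).clarkeDirDeriv_le ?_
    have h1 := fun i => (hℓ (q i x)).eventually_quotient_comp_le (hq i) (ha _) d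
      (show a (q i x) * clarkeDirDeriv (q i) x (-d) <
        a (q i x) * clarkeDirDeriv (q i) x (-d) + δ / N by linarith [div_pos hδ hN])
    filter_upwards [eventually_all.2 h1] with ys h
    rw [← Finset.sum_sub_distrib, Finset.sum_div]
    refine (Finset.sum_le_sum fun i _ => h i).trans (le_of_eq ?_)
    rw [Finset.sum_add_distrib]
    simp
    field_simp
  obtain ⟨Φ, hΦ1, hΦ2⟩ := exists_sum_of_le_sum_sublinear
    (innerₛₗ ℝ g) (fun i d => a (q i x) * clarkeDirDeriv (q i) x (-d))
    (fun i c hc d => by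
      simp only [← smul_neg, clarkeDirDeriv_smul (hq i) x _ hc]
      ring)
    (fun i d e => by
      simp only [neg_add]
      have := clarkeDirDeriv_add_le (hq i) x (-d) (-e)
      nlinarith [ha (q i x)])
    (fun d => by simpa using key d)
  let η : Fin N → Param p := fun i =>
    (InnerProductSpace.toDual ℝ (Param p)).symm (LinearMap.toContinuousLinearMap (Φ i))
  have hη : ∀ i d, inner ℝ (η i) d = Φ i d := fun i d => by simp [η]
  -- `Φ i` is dominated by `a · (q i)°(x; -·)`; dividing by `-a` undoes the reversal and the factor.
  refine ⟨fun i => (-(a (q i x))⁻¹) • η i, fun i d => ?_, ?_⟩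
  · have h := hΦ1 i (-d)
    simp only [neg_neg] at h
    rw [real_inner_smul_left, hη]
    rw [map_neg] at h
    have := ha (q i x)
    rw [neg_mul, inv_mul_eq_div, ← neg_div, div_le_iff₀ this]
    linarith
  · refine ext_inner_right ℝ fun d => ?_
    have h := hΦ2 d
    simp only [innerₛₗ_apply_apply] at h
    rw [h, inner_neg_left, sum_inner, ← Finset.sum_neg_distrib]
    refine Finset.sum_congr rfl fun i _ => ?_
    rw [smul_smul, real_inner_smul_left, hη]
    have := (ha (q i x)).ne'
    field_simp

end ClarkeCalculus

/-! ### Properties shared by the exponential and logistic losses. -/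

section Loss

/-- A loss `ℓ` with derivative `-a` and inverse function `ψ` whose slope has an exponential tail
and for which `x a(x) / ℓ(x)` is monotone on `(0, ∞)`. -/
structure IsExpTailLoss (ℓ a ψ : ℝ → ℝ) : Prop where
  pos : ∀ x, 0 < ℓ x
  slope_pos : ∀ x, 0 < a x
  hasStrictDerivAt : ∀ x, HasStrictDerivAt ℓ (-a x) x
  left_inv : ∀ x, ψ (ℓ x) = x
  right_inv : ∀ u, 0 < u → ℓ (ψ u) = u
  inv_hasStrictDerivAt : ∀ u, 0 < u → HasStrictDerivAt ψ (-(a (ψ u))⁻¹) u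
  mul_slope_mono : ∀ x y, 0 < x → x ≤ y → a x * x * ℓ y ≤ a y * y * ℓ x
  slope_lower : ∀ x, 0 ≤ x → Real.exp (-x) / 2 ≤ a x
  slope_upper : ∀ x, a x ≤ Real.exp (-x)

theorem isExpTailLoss_exp :
    IsExpTailLoss (fun x => Real.exp (-expLossExponent x)) (fun x => Real.exp (-x))
      (fun u => -Real.log u) where
  pos x := Real.exp_pos _
  slope_pos x := Real.exp_pos _
  hasStrictDerivAt x := by
    unfold expLossExponent
    simpa using (hasStrictDerivAt_id x).fun_neg.exp
  left_inv x := by simp [expLossExponent]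
  right_inv u hu := by simp [expLossExponent, Real.exp_log hu]
  inv_hasStrictDerivAt u hu := by
    simpa [Real.exp_log hu] using (Real.hasStrictDerivAt_log hu.ne').fun_neg
  mul_slope_mono x y hx hxy := by
    have : 0 < Real.exp (-x) * Real.exp (-y) := by positivity
    simp only [expLossExponent]
    nlinarith
  slope_lower x hx := by linarith [Real.exp_pos (-x)]
  slope_upper x := le_rfl

theorem exp_neg_logisticLossExponent (x : ℝ) :
    Real.exp (-logisticLossExponent x) = Real.log (1 + Real.exp (-x)) := by
  rw [logisticLossExponent, neg_neg, Real.exp_log]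
  exact Real.log_pos (by linarith [Real.exp_pos (-x)])

/-- `(1 - e^{-u}) / u` decreases: it is a chord slope of the convex exponential, with `-u` between
`-v` and `0`. -/
theorem exp_slope_antitone {u v : ℝ} (hu : 0 < u) (huv : u ≤ v) :
    (1 - Real.exp (-v)) * u ≤ (1 - Real.exp (-u)) * v := by
  have hv : 0 < v := hu.trans_le huv
  have h := convexOn_exp.2 (Set.mem_univ (-v)) (Set.mem_univ 0)
    (show 0 ≤ u / v by positivity) (show 0 ≤ 1 - u / v by rw [sub_nonneg, div_le_one hv]; exact huv)
    (by ring)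
  have e : u / v * -v = -u := by field_simp
  simp only [smul_eq_mul, mul_zero, add_zero, Real.exp_zero, mul_one, e] at h
  have h2 := mul_le_mul_of_nonneg_right h hv.le
  have e2 : (u / v * Real.exp (-v) + (1 - u / v)) * v = u * Real.exp (-v) + (v - u) := by
    field_simp
  rw [e2] at h2
  linarith

theorem isExpTailLoss_logistic :
    IsExpTailLoss (fun x => Real.exp (-logisticLossExponent x)) (fun x => (1 + Real.exp x)⁻¹)
      (fun u => -Real.log (Real.exp u - 1)) := by
  simp only [exp_neg_logisticLossExponent]
  have hpos : ∀ x, 0 < Real.log (1 + Real.exp (-x)) := fun x =>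
    Real.log_pos (by linarith [Real.exp_pos (-x)])
  have hexp : ∀ x, Real.exp (Real.log (1 + Real.exp (-x))) = 1 + Real.exp (-x) := fun x =>
    Real.exp_log (by positivity)
  have hone : ∀ u : ℝ, 0 < u → 0 < Real.exp u - 1 := fun u hu => by
    linarith [Real.add_one_lt_exp hu.ne']
  have hslope : ∀ x, (1 + Real.exp x)⁻¹ = 1 - Real.exp (-Real.log (1 + Real.exp (-x))) := by
    intro x
    rw [Real.exp_neg, hexp, Real.exp_neg]
    have := Real.exp_pos x
    field_simp
    ring
  refine ⟨hpos, fun x => by positivity, fun x => ?_, fun x => ?_, fun u hu => ?_, fun u hu => ?_,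
    fun x y hx hxy => ?_, fun x hx => ?_, fun x => ?_⟩
  · have h := ((hasStrictDerivAt_id x).fun_neg.exp.const_add 1).log
      (by simp only [id]; positivity)
    refine h.congr_deriv ?_
    simp only [id]
    rw [Real.exp_neg]
    have := Real.exp_pos x
    field_simp
    ring
  · simp [hexp]
  · rw [neg_neg, Real.exp_log (hone u hu)]
    simp
  · have h := ((show HasStrictDerivAt (fun x => Real.exp x - 1) (Real.exp u) u from
      (Real.hasStrictDerivAt_exp u).sub_const 1).log (hone u hu).ne').fun_neg
    refine h.congr_deriv ?_
    rw [Real.exp_neg, Real.exp_log (hone u hu)]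
    have := hone u hu
    have := Real.exp_pos u
    field_simp
    ring
  -- The logistic slope is `1 - e^{-ℓ}`, so `a / ℓ` increases as `ℓ` decreases, and multiplying by
  -- `x` preserves this.
  · rw [hslope x, hslope y]
    have hle : Real.log (1 + Real.exp (-y)) ≤ Real.log (1 + Real.exp (-x)) :=
      Real.log_le_log (by positivity) (by simpa using hxy)
    have h := exp_slope_antitone (hpos y) hle
    set U := Real.log (1 + Real.exp (-x))
    set V := Real.log (1 + Real.exp (-y))
    have hV : 0 ≤ 1 - Real.exp (-V) := by
      have : Real.exp (-V) ≤ 1 := Real.exp_le_one_iff.2 (by linarith [hpos y])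
      linarith
    calc (1 - Real.exp (-U)) * x * V = ((1 - Real.exp (-U)) * V) * x := by ring
      _ ≤ ((1 - Real.exp (-V)) * U) * x := mul_le_mul_of_nonneg_right h hx.le
      _ ≤ ((1 - Real.exp (-V)) * U) * y :=
          mul_le_mul_of_nonneg_left hxy (mul_nonneg hV (hpos x).le)
      _ = _ := by ring
  · rw [Real.exp_neg, div_eq_mul_inv, ← mul_inv]
    have := Real.one_le_exp hx
    gcongr
    linarith
  · rw [Real.exp_neg]
    gcongr
    linarith

theorem exists_isExpTailLoss {f : ℝ → ℝ}
    (hf : f = expLossExponent ∨ f = logisticLossExponent) :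
    ∃ a ψ, IsExpTailLoss (fun x => Real.exp (-f x)) a ψ := by
  rcases hf with rfl | rfl
  · exact ⟨_, _, isExpTailLoss_exp⟩
  · exact ⟨_, _, isExpTailLoss_logistic⟩

theorem lossExponent_pos {f : ℝ → ℝ} (hf : f = expLossExponent ∨ f = logisticLossExponent)
    {s : ℝ} (hs : 0 < s) : 0 < f s := by
  rcases hf with rfl | rfl
  · exact hs
  · have h1 : Real.exp (-s) < 1 := Real.exp_lt_one_iff.2 (by linarith)
    have h2 : Real.log (1 + Real.exp (-s)) < 1 := by
      rw [Real.log_lt_iff_lt_exp (by positivity)]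
      linarith [Real.add_one_lt_exp one_ne_zero]
    have h3 := Real.log_neg (Real.log_pos (by linarith [Real.exp_pos (-s)])) h2
    simpa [logisticLossExponent] using h3

namespace IsExpTailLoss

variable {ℓ a ψ : ℝ → ℝ}

theorem strictAnti (h : IsExpTailLoss ℓ a ψ) : StrictAnti ℓ :=
  strictAnti_of_deriv_neg fun x => by
    rw [(h.hasStrictDerivAt x).hasDerivAt.deriv]
    linarith [h.slope_pos x]

theorem inv_le_of_le (h : IsExpTailLoss ℓ a ψ) {u x : ℝ} (hu : 0 < u) (hx : ℓ x ≤ u) : ψ u ≤ x := by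
  rw [← h.right_inv u hu] at hx
  exact h.strictAnti.le_iff_ge.1 hx

theorem lt_inv_of_lt (h : IsExpTailLoss ℓ a ψ) {u x : ℝ} (hu : 0 < u) (hx : u < ℓ x) : x < ψ u := by
  rw [← h.right_inv u hu] at hx
  exact h.strictAnti.lt_iff_gt.1 hx

theorem inv_le_of_sum (h : IsExpTailLoss ℓ a ψ) {N : ℕ} (q : Fin N → ℝ) (i : Fin N) : ψ (∑ k, ℓ (q k)) ≤ q i := by
  have h1 : ℓ (q i) ≤ ∑ k, ℓ (q k) :=
    Finset.single_le_sum (f := fun k => ℓ (q k)) (fun k _ => (h.pos _).le) (Finset.mem_univ i)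
  exact h.inv_le_of_le ((h.pos _).trans_le h1) h1

/-- Every margin is at least `ψ(Λ)`, so `a(q) q / ℓ(q)` is at least its value at `ψ(Λ)`, where `ℓ =
Λ`. Weighting by `ℓ(q i)` and summing cancels `Λ`. -/
theorem slope_inv_mul_le_sum (h : IsExpTailLoss ℓ a ψ) {N : ℕ} [Nonempty (Fin N)] (q : Fin N → ℝ)
    (hψ : 0 < ψ (∑ k, ℓ (q k))) :
    a (ψ (∑ k, ℓ (q k))) * ψ (∑ k, ℓ (q k)) ≤ ∑ i, a (q i) * q i := by
  have hpos : 0 < ∑ k, ℓ (q k) := Finset.sum_pos (fun k _ => h.pos _) Finset.univ_nonempty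
  have h1 := Finset.sum_le_sum fun i (_ : i ∈ Finset.univ) =>
    h.mul_slope_mono _ _ hψ (h.inv_le_of_sum q i)
  rw [← Finset.mul_sum, ← Finset.sum_mul, h.right_inv _ hpos] at h1
  exact le_of_mul_le_mul_right h1 hpos

end IsExpTailLoss

end Loss

/-! ### Compositions and monotonicity of absolutely continuous functions. -/

section AbsolutelyContinuous

theorem LipschitzOnWith.comp_absolutelyContinuousOnInterval {X Y : Type*} [PseudoMetricSpace X]
    [PseudoMetricSpace Y] {Φ : X → Y} {K : NNReal} {z : ℝ → X} {a b : ℝ}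
    (hΦ : LipschitzOnWith K Φ (z '' Set.uIcc a b)) (hz : AbsolutelyContinuousOnInterval z a b) :
    AbsolutelyContinuousOnInterval (fun t => Φ (z t)) a b := by
  rw [absolutelyContinuousOnInterval_iff] at hz ⊢
  intro ε hε
  obtain ⟨δ, hδ, h⟩ := hz (ε / (K + 1)) (by positivity)
  refine ⟨δ, hδ, fun E hE hlt => ?_⟩
  have h1 := h E hE hlt
  rw [lt_div_iff₀ (by positivity)] at h1
  refine lt_of_le_of_lt ?_ h1
  rw [Finset.sum_mul]
  refine Finset.sum_le_sum fun i hi => ?_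
  have h2 := hΦ.dist_le_mul _ (Set.mem_image_of_mem z (hE.1 i hi).1) _
    (Set.mem_image_of_mem z (hE.1 i hi).2)
  nlinarith [dist_nonneg (x := z (E.2 i).1) (y := z (E.2 i).2)]

theorem LocallyLipschitzOn.comp_absolutelyContinuousOnInterval {X Y : Type*}
    [NormedAddCommGroup X] [PseudoMetricSpace Y] {Φ : X → Y} {U : Set X} {z : ℝ → X} {a b : ℝ}
    (hΦ : LocallyLipschitzOn U Φ) (hz : AbsolutelyContinuousOnInterval z a b)
    (hU : ∀ t ∈ Set.uIcc a b, z t ∈ U) :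
    AbsolutelyContinuousOnInterval (fun t => Φ (z t)) a b := by
  obtain ⟨K, hK⟩ := (hΦ.mono (Set.image_subset_iff.2 hU)).exists_lipschitzOnWith_of_compact
    (isCompact_uIcc.image_of_continuousOn hz.continuousOn)
  exact hK.comp_absolutelyContinuousOnInterval hz

theorem LocallyLipschitz.comp_absolutelyContinuousOnInterval {X Y : Type*}
    [NormedAddCommGroup X] [PseudoMetricSpace Y] {Φ : X → Y} {z : ℝ → X} {a b : ℝ}
    (hΦ : LocallyLipschitz Φ) (hz : AbsolutelyContinuousOnInterval z a b) :
    AbsolutelyContinuousOnInterval (fun t => Φ (z t)) a b :=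
  (hΦ.locallyLipschitzOn (s := Set.univ)).comp_absolutelyContinuousOnInterval hz
    fun _ _ => Set.mem_univ _

/-- Strict differentiability supplies a local Lipschitz bound near each value, which is uniform on
the compact image. -/
theorem AbsolutelyContinuousOnInterval.comp_of_hasStrictDerivAt {Φ Φ' z : ℝ → ℝ} {a b : ℝ}
    (hz : AbsolutelyContinuousOnInterval z a b)
    (hΦ : ∀ t ∈ Set.uIcc a b, HasStrictDerivAt Φ (Φ' t) (z t)) :
    AbsolutelyContinuousOnInterval (fun t => Φ (z t)) a b := by
  refine LocallyLipschitzOn.comp_absolutelyContinuousOnInterval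
    (U := {x | ∃ c, HasStrictDerivAt Φ c x}) (fun x hx => ?_) hz fun t ht => ⟨_, hΦ t ht⟩
  obtain ⟨c, hc⟩ := hx
  obtain ⟨K, s, hs, hK⟩ := hc.hasStrictFDerivAt.exists_lipschitzOnWith
  exact ⟨K, s, mem_nhdsWithin_of_mem_nhds hs, hK⟩

theorem AbsolutelyContinuousOnInterval.finset_sum {ι : Type*} (s : Finset ι) {z : ι → ℝ → ℝ}
    {a b : ℝ} (hz : ∀ i ∈ s, AbsolutelyContinuousOnInterval (z i) a b) :
    AbsolutelyContinuousOnInterval (fun t => ∑ i ∈ s, z i t) a b := by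
  classical
  induction s using Finset.induction_on with
  | empty =>
    simp only [Finset.sum_empty]
    exact ContDiffOn.absolutelyContinuousOnInterval contDiffOn_const
  | insert i s hi ih =>
    simp only [Finset.sum_insert hi]
    exact (hz i (Finset.mem_insert_self i s)).fun_add
      (ih fun j hj => hz j (Finset.mem_insert_of_mem hj))

theorem AbsolutelyContinuousOnInterval.apply {p : ℕ} {z : ℝ → Param p} {a b : ℝ}
    (hz : AbsolutelyContinuousOnInterval z a b) (j : Fin p) :
    AbsolutelyContinuousOnInterval (fun t => z t j) a b := by
  refine LipschitzOnWith.comp_absolutelyContinuousOnInterval (Φ := fun x : Param p => x j) (K := 1)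
    (LipschitzOnWith.of_dist_le_mul fun x _ y _ => ?_) hz
  rw [NNReal.coe_one, one_mul, dist_eq_norm, dist_eq_norm]
  exact PiLp.norm_apply_le (x - y) j

/-- An absolutely continuous function with almost everywhere nonnegative derivative increases. -/
theorem AbsolutelyContinuousOnInterval.le_of_ae_hasDerivAt_nonneg {z : ℝ → ℝ} {a b : ℝ}
    (hz : AbsolutelyContinuousOnInterval z a b) (hab : a ≤ b)
    (h : ∀ᵐ t : ℝ, t ∈ Set.Ioo a b → ∃ c, 0 ≤ c ∧ HasDerivAt z c t) : z a ≤ z b := by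
  have h1 : 0 ≤ ∫ t in a..b, deriv z t := by
    rw [intervalIntegral.integral_of_le hab, integral_Ioc_eq_integral_Ioo]
    refine setIntegral_nonneg_of_ae_restrict ?_
    rw [EventuallyLE, ae_restrict_iff' measurableSet_Ioo]
    filter_upwards [h] with t ht hmem
    obtain ⟨c, hc, hd⟩ := ht hmem
    simpa [hd.deriv] using hc
  rw [hz.integral_deriv_eq_sub] at h1
  linarith

end AbsolutelyContinuous

/-! ### Derivatives along the flow at regular times. -/

noncomputable section

section Flow

/-- The accumulated second moment `ε + ∫₀ᵗ gⱼ²`, so that `hⱼ = 1 / √Sⱼ`. -/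
def secondMoment {p : ℕ} (ε : ℝ) (g : ℝ → Param p) (j : Fin p) (t : ℝ) : ℝ :=
  ε + ∫ τ in (0 : ℝ)..t, (g τ j) ^ 2

/-- The squared norm of `w(t)` in the time-dependent metric given by `h(t)⁻¹`. -/
def adaptiveSqNorm {p : ℕ} (ε : ℝ) (g w : ℝ → Param p) (t : ℝ) : ℝ :=
  ∑ j, w t j ^ 2 * √(secondMoment ε g j t)

/-- The rate of decrease of the loss along the flow. -/
def dissipation {p : ℕ} (ε : ℝ) (g : ℝ → Param p) (t : ℝ) : ℝ :=
  ∑ j, g t j ^ 2 / √(secondMoment ε g j t)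

/-- The logarithm of the adaptive norm. -/
def logAdaptiveNorm {p : ℕ} (ε : ℝ) (g w : ℝ → Param p) (t : ℝ) : ℝ :=
  1 / 2 * Real.log (adaptiveSqNorm ε g w t)

/-- Half of the logarithm of `∏ⱼ hⱼ⁻¹`. -/
def logConditioner {p : ℕ} (ε : ℝ) (g : ℝ → Param p) (t : ℝ) : ℝ :=
  1 / 4 * ∑ j, Real.log (secondMoment ε g j t)

variable {p N : ℕ} {ℓ a ψ : ℝ → ℝ} {q : Fin N → Param p → ℝ} {L ε : ℝ} {w g : ℝ → Param p}

/-- The loss along a curve. -/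
def lossAlong (ℓ : ℝ → ℝ) (q : Fin N → Param p → ℝ) (w : ℝ → Param p) (t : ℝ) : ℝ :=
  ∑ i, ℓ (q i (w t))

/-- The loss-weighted margin; it equals `-⟨w, g⟩` along the flow. -/
def weightedMargin (a : ℝ → ℝ) (q : Fin N → Param p → ℝ) (L : ℝ) (w : ℝ → Param p) (t : ℝ) : ℝ :=
  L * ∑ i, a (q i (w t)) * q i (w t)

/-- The logarithm of the surrogate margin, corrected so as to be monotone. -/
def logSurrogateMargin (ℓ ψ : ℝ → ℝ) (q : Fin N → Param p → ℝ) (L ε : ℝ) (g w : ℝ → Param p)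
    (t : ℝ) : ℝ :=
  Real.log (ψ (lossAlong ℓ q w t)) - L * logAdaptiveNorm ε g w t + L * logConditioner ε g t

/-- The standing assumptions: an AdaGrad flow for a loss with exponential tail and homogeneous
margins. -/
structure IsMarginFlow (ℓ a ψ : ℝ → ℝ) (q : Fin N → Param p → ℝ) (L ε : ℝ)
    (w g : ℝ → Param p) : Prop where
  nonempty : Nonempty (Fin N)
  loss : IsExpTailLoss ℓ a ψ
  lip : ∀ i, LocallyLipschitz (q i)
  chain : ∀ i, AdmitsChainRule (q i)
  order_pos : 0 < L
  hom : ∀ i, ∀ α : ℝ, 0 < α → ∀ x, q i (α • x) = α ^ L * q i x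
  eps_pos : 0 < ε
  flow : IsAdaGradFlow (fun x => ∑ i, ℓ (q i x)) ε w g

/-- A time at which all relevant functions are differentiable, with Clarke subgradients `ξ i` of
the margins. -/
structure IsRegularTime (a : ℝ → ℝ) (q : Fin N → Param p → ℝ) (ε : ℝ)
    (w g : ℝ → Param p) (t : ℝ) (ξ : Fin N → Param p) : Prop where
  pos : 0 < t
  mem : ∀ i, ξ i ∈ clarkeSubdiff (q i) (w t)
  grad : g t = -∑ i, a (q i (w t)) • ξ i
  deriv : HasDerivAt w (-hadamard (adagradConditioner ε g t) (g t)) t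
  margin_deriv : ∀ i, HasDerivAt (fun s => q i (w s))
    (inner ℝ (ξ i) (-hadamard (adagradConditioner ε g t) (g t))) t
  moment_deriv : ∀ j, HasDerivAt (secondMoment ε g j) (g t j ^ 2) t

namespace IsMarginFlow

theorem ae_isRegularTime (h : IsMarginFlow ℓ a ψ q L ε w g) :
    ∀ᵐ t : ℝ, 0 < t → ∃ ξ, IsRegularTime a q ε w g t ξ := by
  have := h.nonempty
  -- Absolute continuity and integrability hold on compact intervals only; countably many intervals
  -- `[0, n]` keep the exceptional set null.
  have h1 : ∀ᵐ t : ℝ, ∀ (i : Fin N) (n : ℕ), t ∈ Set.Ioo (0 : ℝ) n →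
      ∀ ξ ∈ clarkeSubdiff (q i) (w t),
        HasDerivAt (fun s => q i (w s)) (inner ℝ ξ (_root_.deriv w t)) t := by
    rw [ae_all_iff]
    intro i
    rw [ae_all_iff]
    intro n
    exact h.chain i w 0 n (h.flow.absolutelyContinuous n n.cast_nonneg)
  have h2 : ∀ᵐ t : ℝ, ∀ (j : Fin p) (n : ℕ), t ∈ Set.uIcc (0 : ℝ) n →
      ∀ c ∈ Set.uIcc (0 : ℝ) n,
        HasDerivAt (fun x => ∫ τ in c..x, (g τ j) ^ 2) (g t j ^ 2) t := by
    rw [ae_all_iff]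
    intro j
    rw [ae_all_iff]
    intro n
    exact (h.flow.integrable_sq n n.cast_nonneg j).ae_hasDerivAt_integral
  filter_upwards [h1, h2, h.flow.subgradient, h.flow.flow] with t h1 h2 h3 h4 ht
  obtain ⟨n, hn⟩ := exists_nat_gt t
  obtain ⟨ξ, hξ, hg⟩ := exists_of_mem_clarkeSubdiff_sum_comp h.lip h.loss.hasStrictDerivAt
    h.loss.slope_pos (h3 ht)
  refine ⟨ξ, ht, hξ, hg, h4 ht, fun i => ?_, fun j => ?_⟩
  · have := h1 i n ⟨ht, hn⟩ (ξ i) (hξ i)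
    rwa [(h4 ht).deriv] at this
  · refine (h2 j n ?_ 0 Set.left_mem_uIcc).const_add ε
    rw [Set.uIcc_of_le n.cast_nonneg]
    exact ⟨ht.le, hn.le⟩

theorem secondMoment_mono (h : IsMarginFlow ℓ a ψ q L ε w g) (j : Fin p) {s t : ℝ} (hs : 0 ≤ s)
    (hst : s ≤ t) : secondMoment ε g j s ≤ secondMoment ε g j t := by
  unfold secondMoment
  have h1 := h.flow.integrable_sq s hs j
  have h2 := h.flow.integrable_sq t (hs.trans hst) j
  have h3 := intervalIntegral.integral_interval_sub_left h2 h1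
  have h4 : 0 ≤ ∫ τ in s..t, (g τ j) ^ 2 :=
    intervalIntegral.integral_nonneg hst fun τ _ => sq_nonneg _
  linarith

theorem eps_le_secondMoment (h : IsMarginFlow ℓ a ψ q L ε w g) (j : Fin p) {t : ℝ}
    (ht : 0 ≤ t) : ε ≤ secondMoment ε g j t := by
  have := h.secondMoment_mono j le_rfl ht
  simpa [secondMoment] using this

theorem secondMoment_pos (h : IsMarginFlow ℓ a ψ q L ε w g) (j : Fin p) {t : ℝ}
    (ht : 0 ≤ t) : 0 < secondMoment ε g j t :=
  h.eps_pos.trans_le (h.eps_le_secondMoment j ht)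

theorem dissipation_nonneg (ε : ℝ) (g : ℝ → Param p) (t : ℝ) : 0 ≤ dissipation ε g t :=
  Finset.sum_nonneg fun j _ => by positivity

theorem lossAlong_pos (h : IsMarginFlow ℓ a ψ q L ε w g) (t : ℝ) : 0 < lossAlong ℓ q w t := by
  have := h.nonempty
  exact Finset.sum_pos (fun i _ => h.loss.pos _) Finset.univ_nonempty

theorem hasDerivAt_lossAlong (h : IsMarginFlow ℓ a ψ q L ε w g) {t : ℝ} {ξ : Fin N → Param p}
    (ht : IsRegularTime a q ε w g t ξ) :
    HasDerivAt (lossAlong ℓ q w) (-dissipation ε g t) t := by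
  have h1 : HasDerivAt (lossAlong ℓ q w) (∑ i, -a (q i (w t)) *
      inner ℝ (ξ i) (-hadamard (adagradConditioner ε g t) (g t))) t :=
    HasDerivAt.fun_sum fun i _ =>
      (h.loss.hasStrictDerivAt (q i (w t))).hasDerivAt.comp t (ht.margin_deriv i)
  refine h1.congr_deriv ?_
  have h2 : ∑ i, -a (q i (w t)) * inner ℝ (ξ i) (-hadamard (adagradConditioner ε g t) (g t)) =
      inner ℝ (g t) (-hadamard (adagradConditioner ε g t) (g t)) := by
    conv_rhs => rw [ht.grad]
    rw [inner_neg_left, sum_inner, ← Finset.sum_neg_distrib]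
    refine Finset.sum_congr rfl fun i _ => ?_
    rw [real_inner_smul_left, neg_mul, ← ht.grad]
  rw [h2, inner_neg_right, dissipation, PiLp.inner_apply]
  congr 1
  refine Finset.sum_congr rfl fun j _ => ?_
  simp only [hadamard, adagradConditioner, secondMoment, RCLike.inner_apply, conj_trivial]
  ring

theorem sum_mul_eq_neg_weightedMargin (h : IsMarginFlow ℓ a ψ q L ε w g) {t : ℝ}
    {ξ : Fin N → Param p} (ht : IsRegularTime a q ε w g t ξ) :
    ∑ j, w t j * g t j = -weightedMargin a q L w t := by
  have h1 : inner ℝ (g t) (w t) = -weightedMargin a q L w t := by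
    rw [ht.grad, inner_neg_left, sum_inner, weightedMargin, Finset.mul_sum]
    congr 1
    refine Finset.sum_congr rfl fun i _ => ?_
    rw [real_inner_smul_left,
      inner_eq_of_mem_clarkeSubdiff (h.lip i) (h.chain i) (h.hom i) (ht.mem i)]
    ring
  rw [← h1, PiLp.inner_apply]
  exact Finset.sum_congr rfl fun j _ => by simp

/-- Cauchy–Schwarz for `⟨w, g⟩` in the metric `h⁻¹` and its dual. Its defect drives the whole
argument. -/
theorem weightedMargin_sq_le (h : IsMarginFlow ℓ a ψ q L ε w g) {t : ℝ}
    {ξ : Fin N → Param p} (ht : IsRegularTime a q ε w g t ξ) :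
    weightedMargin a q L w t ^ 2 ≤ dissipation ε g t * adaptiveSqNorm ε g w t := by
  have h1 : weightedMargin a q L w t ^ 2 = (∑ j, w t j * g t j) ^ 2 := by
    rw [h.sum_mul_eq_neg_weightedMargin ht]
    ring
  rw [h1]
  refine Finset.sum_sq_le_sum_mul_sum_of_sq_le_mul _ (fun j _ => by positivity)
    (fun j _ => by positivity) fun j _ => le_of_eq ?_
  have := Real.sqrt_pos.2 (h.secondMoment_pos j ht.pos.le)
  field_simp

theorem hasDerivAt_apply {t : ℝ} {ξ : Fin N → Param p} (ht : IsRegularTime a q ε w g t ξ)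
    (j : Fin p) : HasDerivAt (fun s => w s j) (-(g t j / √(secondMoment ε g j t))) t := by
  have h1 := (PiLp.hasFDerivAt_apply (𝕜 := ℝ) 2 (w t) j).comp_hasDerivAt t ht.deriv
  refine h1.congr_deriv ?_
  simp [hadamard, adagradConditioner, secondMoment]
  ring

theorem hasDerivAt_sqrt_secondMoment (h : IsMarginFlow ℓ a ψ q L ε w g) {t : ℝ}
    {ξ : Fin N → Param p} (ht : IsRegularTime a q ε w g t ξ) (j : Fin p) :
    HasDerivAt (fun s => √(secondMoment ε g j s))
      (g t j ^ 2 / (2 * √(secondMoment ε g j t))) t :=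
  (ht.moment_deriv j).sqrt (h.secondMoment_pos j ht.pos.le).ne'

/-- Moving `w` contributes `-2⟨w, g⟩`, because the metric cancels the conditioner; the remaining sum
comes from the growth of the metric. -/
theorem hasDerivAt_adaptiveSqNorm (h : IsMarginFlow ℓ a ψ q L ε w g) {t : ℝ}
    {ξ : Fin N → Param p} (ht : IsRegularTime a q ε w g t ξ) :
    HasDerivAt (adaptiveSqNorm ε g w) (2 * weightedMargin a q L w t +
      1 / 2 * ∑ j, w t j ^ 2 * g t j ^ 2 / √(secondMoment ε g j t)) t := by
  have h1 : HasDerivAt (adaptiveSqNorm ε g w) (∑ j, _) t :=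
    HasDerivAt.fun_sum fun j _ =>
      ((hasDerivAt_apply ht j).fun_pow 2).fun_mul (h.hasDerivAt_sqrt_secondMoment ht j)
  refine h1.congr_deriv ?_
  have h2 : weightedMargin a q L w t = -∑ j, w t j * g t j := by
    rw [h.sum_mul_eq_neg_weightedMargin ht, neg_neg]
  rw [h2, mul_neg, ← neg_mul, Finset.mul_sum, Finset.mul_sum, ← Finset.sum_add_distrib]
  refine Finset.sum_congr rfl fun j _ => ?_
  have := Real.sqrt_pos.2 (h.secondMoment_pos j ht.pos.le)
  field_simp
  norm_num
  ring

theorem hasDerivAt_logConditioner (h : IsMarginFlow ℓ a ψ q L ε w g) {t : ℝ}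
    {ξ : Fin N → Param p} (ht : IsRegularTime a q ε w g t ξ) :
    HasDerivAt (logConditioner ε g) (1 / 4 * ∑ j, g t j ^ 2 / secondMoment ε g j t) t :=
  (HasDerivAt.fun_sum fun j _ =>
    (ht.moment_deriv j).log (h.secondMoment_pos j ht.pos.le).ne').const_mul _

/-- Each `w_j² √S_j` is at most the full squared norm, so the metric's growth adds between zero and
the derivative of `logConditioner`. -/
theorem hasDerivAt_logAdaptiveNorm (h : IsMarginFlow ℓ a ψ q L ε w g) {t : ℝ}
    {ξ : Fin N → Param p} (ht : IsRegularTime a q ε w g t ξ)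
    (hR : 0 < adaptiveSqNorm ε g w t) :
    ∃ c, HasDerivAt (logAdaptiveNorm ε g w) c t ∧
      weightedMargin a q L w t / adaptiveSqNorm ε g w t ≤ c ∧
      c ≤ weightedMargin a q L w t / adaptiveSqNorm ε g w t +
        1 / 4 * ∑ j, g t j ^ 2 / secondMoment ε g j t := by
  refine ⟨_, ((h.hasDerivAt_adaptiveSqNorm ht).log hR.ne').const_mul (1 / 2), ?_, ?_⟩
  · have h1 : 0 ≤ ∑ j, w t j ^ 2 * g t j ^ 2 / √(secondMoment ε g j t) :=
      Finset.sum_nonneg fun j _ => by positivity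
    rw [← mul_div_assoc]
    gcongr
    linarith
  · have h1 : ∑ j, w t j ^ 2 * g t j ^ 2 / √(secondMoment ε g j t) ≤
        (∑ j, g t j ^ 2 / secondMoment ε g j t) * adaptiveSqNorm ε g w t := by
      rw [Finset.sum_mul]
      refine Finset.sum_le_sum fun j _ => ?_
      have hS := h.secondMoment_pos j ht.pos.le
      have h2 : w t j ^ 2 * √(secondMoment ε g j t) ≤ adaptiveSqNorm ε g w t :=
        Finset.single_le_sum (f := fun j => w t j ^ 2 * √(secondMoment ε g j t))
          (fun k _ => by positivity) (Finset.mem_univ j)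
      have h3 : w t j ^ 2 * g t j ^ 2 / √(secondMoment ε g j t) =
          g t j ^ 2 / secondMoment ε g j t * (w t j ^ 2 * √(secondMoment ε g j t)) := by
        have h4 := Real.sqrt_pos.2 hS
        nth_rewrite 2 [← Real.mul_self_sqrt hS.le]
        field_simp
      rw [h3]
      exact mul_le_mul_of_nonneg_left h2 (by positivity)
    have h2 : 1 / 4 * ∑ j, g t j ^ 2 / secondMoment ε g j t =
        1 / 4 * ((∑ j, g t j ^ 2 / secondMoment ε g j t) * adaptiveSqNorm ε g w t) /
          adaptiveSqNorm ε g w t := by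
      field_simp
    rw [h2, ← add_div, ← mul_div_assoc]
    gcongr
    linarith

theorem margin_zero (h : IsMarginFlow ℓ a ψ q L ε w g) (i : Fin N) : q i 0 = 0 := by
  have h1 := h.hom i 2 (by norm_num) 0
  rw [smul_zero] at h1
  have h2 : (1 : ℝ) < 2 ^ L := Real.one_lt_rpow (by norm_num) h.order_pos
  have h3 : ((2 : ℝ) ^ L - 1) * q i 0 = 0 := by linarith
  rcases mul_eq_zero.1 h3 with h4 | h4
  · linarith
  · exact h4

theorem margin_pos (h : IsMarginFlow ℓ a ψ q L ε w g) {t : ℝ}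
    (hψ : 0 < ψ (lossAlong ℓ q w t)) (i : Fin N) : 0 < q i (w t) :=
  hψ.trans_le (h.loss.inv_le_of_sum (fun i => q i (w t)) i)

theorem ne_zero (h : IsMarginFlow ℓ a ψ q L ε w g) {t : ℝ}
    (hψ : 0 < ψ (lossAlong ℓ q w t)) : w t ≠ 0 := by
  obtain ⟨i⟩ := h.nonempty
  intro h0
  have := h.margin_pos hψ i
  rw [h0, h.margin_zero] at this
  exact this.false

theorem sqrt_eps_mul_le_adaptiveSqNorm (h : IsMarginFlow ℓ a ψ q L ε w g) {t : ℝ}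
    (ht : 0 ≤ t) : √ε * ‖w t‖ ^ 2 ≤ adaptiveSqNorm ε g w t := by
  rw [EuclideanSpace.norm_sq_eq, Finset.mul_sum]
  refine Finset.sum_le_sum fun j _ => ?_
  rw [Real.norm_eq_abs, sq_abs, mul_comm]
  exact mul_le_mul_of_nonneg_left (Real.sqrt_le_sqrt (h.eps_le_secondMoment j ht)) (sq_nonneg _)

theorem adaptiveSqNorm_pos (h : IsMarginFlow ℓ a ψ q L ε w g) {t : ℝ} (ht : 0 ≤ t)
    (hψ : 0 < ψ (lossAlong ℓ q w t)) : 0 < adaptiveSqNorm ε g w t := by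
  have h1 := norm_pos_iff.2 (h.ne_zero hψ)
  have h2 := Real.sqrt_pos.2 h.eps_pos
  exact (by positivity : 0 < √ε * ‖w t‖ ^ 2).trans_le (h.sqrt_eps_mul_le_adaptiveSqNorm ht)

theorem slope_mul_le_weightedMargin (h : IsMarginFlow ℓ a ψ q L ε w g) {t : ℝ}
    (hψ : 0 < ψ (lossAlong ℓ q w t)) :
    L * (a (ψ (lossAlong ℓ q w t)) * ψ (lossAlong ℓ q w t)) ≤ weightedMargin a q L w t := by
  have := h.nonempty
  exact mul_le_mul_of_nonneg_left (h.loss.slope_inv_mul_le_sum (fun i => q i (w t)) hψ)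
    h.order_pos.le

theorem weightedMargin_pos (h : IsMarginFlow ℓ a ψ q L ε w g) {t : ℝ}
    (hψ : 0 < ψ (lossAlong ℓ q w t)) : 0 < weightedMargin a q L w t :=
  (mul_pos h.order_pos (mul_pos (h.loss.slope_pos _) hψ)).trans_le
    (h.slope_mul_le_weightedMargin hψ)

/-- The derivative of `log ψ(Λ)` is `A / (a(ψ(Λ)) ψ(Λ)) ≥ L A / ν`, and the conditioner term absorbs
the metric's share in the growth of the norm. -/
theorem hasDerivAt_logSurrogateMargin (h : IsMarginFlow ℓ a ψ q L ε w g) {t : ℝ}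
    {ξ : Fin N → Param p} (ht : IsRegularTime a q ε w g t ξ)
    (hψ : 0 < ψ (lossAlong ℓ q w t)) :
    ∃ c, HasDerivAt (logSurrogateMargin ℓ ψ q L ε g w) c t ∧
      L * (dissipation ε g t / weightedMargin a q L w t -
        weightedMargin a q L w t / adaptiveSqNorm ε g w t) ≤ c := by
  obtain ⟨c, hc, -, hc2⟩ := h.hasDerivAt_logAdaptiveNorm ht (h.adaptiveSqNorm_pos ht.pos.le hψ)
  have h1 : HasDerivAt (fun s => ψ (lossAlong ℓ q w s)) _ t :=
    (h.loss.inv_hasStrictDerivAt _ (h.lossAlong_pos t)).hasDerivAt.comp t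
      (h.hasDerivAt_lossAlong ht)
  refine ⟨_, ((h1.log hψ.ne').fun_sub (hc.const_mul L)).fun_add
    ((h.hasDerivAt_logConditioner ht).const_mul L), ?_⟩
  have ha := h.loss.slope_pos (ψ (lossAlong ℓ q w t))
  have h2 : L * (dissipation ε g t / weightedMargin a q L w t) ≤
      dissipation ε g t / (a (ψ (lossAlong ℓ q w t)) * ψ (lossAlong ℓ q w t)) := by
    rw [← mul_div_assoc, div_le_div_iff₀ (h.weightedMargin_pos hψ) (mul_pos ha hψ)]
    have := mul_le_mul_of_nonneg_left (h.slope_mul_le_weightedMargin hψ)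
      (dissipation_nonneg ε g t)
    linarith
  have h3 : -(a (ψ (lossAlong ℓ q w t)))⁻¹ * -dissipation ε g t / ψ (lossAlong ℓ q w t) =
      dissipation ε g t / (a (ψ (lossAlong ℓ q w t)) * ψ (lossAlong ℓ q w t)) := by
    field_simp
  rw [h3, mul_sub]
  have h4 := mul_le_mul_of_nonneg_left hc2 h.order_pos.le
  rw [mul_add] at h4
  linarith

end IsMarginFlow

end Flow

end

/-! ### Boundedness, monotonicity and divergence along the flow. -/

noncomputable section

theorem exists_tendsto_of_monotoneOn_Ici {z : ℝ → ℝ} {t₀ C : ℝ}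
    (hmono : ∀ s t, t₀ ≤ s → s ≤ t → z s ≤ z t) (hC : ∀ t, t₀ ≤ t → z t ≤ C) :
    ∃ l, Tendsto z atTop (𝓝 l) ∧ ∀ t, t₀ ≤ t → z t ≤ l := by
  have h1 : Monotone fun t => z (max t t₀) := fun s t hst =>
    hmono _ _ (le_max_right _ _) (max_le_max_right _ hst)
  have h2 : BddAbove (Set.range fun t => z (max t t₀)) :=
    ⟨C, by rintro _ ⟨t, rfl⟩; exact hC _ (le_max_right _ _)⟩
  refine ⟨_, (tendsto_atTop_ciSup h1 h2).congr' ?_, fun t ht => ?_⟩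
  · filter_upwards [eventually_ge_atTop t₀] with t ht
    rw [max_eq_left ht]
  · have := le_ciSup h2 t
    rwa [max_eq_left ht] at this

section Homogeneous

variable {p N : ℕ} {q : Fin N → Param p → ℝ} {L : ℝ}

theorem exists_le_mul_norm_rpow {F : Param p → ℝ} (hF : Continuous F)
    (hom : ∀ α : ℝ, 0 < α → ∀ x, F (α • x) = α ^ L * F x) :
    ∃ M, 0 < M ∧ ∀ x, x ≠ 0 → F x ≤ M * ‖x‖ ^ L := by
  obtain ⟨C, hC⟩ := (isCompact_sphere (0 : Param p) 1).exists_bound_of_continuousOn hF.continuousOn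
  refine ⟨|C| + 1, by positivity, fun x hx => ?_⟩
  have hn : 0 < ‖x‖ := norm_pos_iff.2 hx
  have h1 : F x = ‖x‖ ^ L * F (‖x‖⁻¹ • x) := by
    rw [← hom _ hn, smul_smul, mul_inv_cancel₀ hn.ne', one_smul]
  have h2 : F (‖x‖⁻¹ • x) ≤ |C| + 1 := by
    have h3 := hC (‖x‖⁻¹ • x) (by simp [norm_smul, hn.ne'])
    have := (abs_le.1 h3).2
    linarith [le_abs_self C]
  rw [h1, mul_comm]
  exact mul_le_mul_of_nonneg_right h2 (by positivity)

/-- Subgradients rescale to the unit sphere, and the ball of radius 2, on which `F` is Lipschitz, is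
a neighbourhood of each of its points. -/
theorem exists_norm_clarkeSubdiff_le {F : Param p → ℝ} (hF : LocallyLipschitz F)
    (hom : ∀ α : ℝ, 0 < α → ∀ x, F (α • x) = α ^ L * F x) :
    ∃ K, 0 ≤ K ∧ ∀ x, x ≠ 0 → ∀ ξ ∈ clarkeSubdiff F x, ‖ξ‖ ≤ K * ‖x‖ ^ (L - 1) := by
  obtain ⟨K, hK⟩ := (hF.locallyLipschitzOn (s := Metric.closedBall 0 2)
    ).exists_lipschitzOnWith_of_compact (isCompact_closedBall (0 : Param p) 2)
  refine ⟨K, K.2, fun x hx ξ hξ => ?_⟩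
  have hn : 0 < ‖x‖ := norm_pos_iff.2 hx
  have h1 := rpow_smul_mem_clarkeSubdiff hF hom hξ (inv_pos.2 hn)
  have h2 : Metric.closedBall (0 : Param p) 2 ∈ 𝓝 (‖x‖⁻¹ • x) := by
    refine mem_of_superset (Metric.ball_mem_nhds _ one_pos) fun y hy => ?_
    have h3 : ‖‖x‖⁻¹ • x‖ = 1 := by simp [norm_smul, hn.ne']
    rw [mem_closedBall_zero_iff]
    rw [mem_ball_iff_norm] at hy
    have := norm_add_le (y - ‖x‖⁻¹ • x) (‖x‖⁻¹ • x)
    rw [sub_add_cancel] at this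
    linarith
  have h4 := norm_le_of_mem_clarkeSubdiff hF hK h2 h1
  rw [norm_smul, Real.norm_eq_abs, abs_of_pos (by positivity), Real.inv_rpow hn.le,
    inv_mul_le_iff₀ (by positivity)] at h4
  linarith

end Homogeneous

namespace IsMarginFlow

variable {p N : ℕ} {ℓ a ψ : ℝ → ℝ} {q : Fin N → Param p → ℝ} {L ε : ℝ} {w g : ℝ → Param p}

theorem ac_flow (h : IsMarginFlow ℓ a ψ q L ε w g) {s t : ℝ} (hs : 0 ≤ s) (hst : s ≤ t) :
    AbsolutelyContinuousOnInterval w s t := by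
  refine (h.flow.absolutelyContinuous t (hs.trans hst)).mono ?_
  rw [Set.uIcc_of_le hst, Set.uIcc_of_le (hs.trans hst)]
  exact Set.Icc_subset_Icc_left hs

theorem ac_secondMoment (h : IsMarginFlow ℓ a ψ q L ε w g) (j : Fin p) {s t : ℝ} (hs : 0 ≤ s)
    (hst : s ≤ t) : AbsolutelyContinuousOnInterval (secondMoment ε g j) s t := by
  have h1 := ((h.flow.integrable_sq t (hs.trans hst)
    j).absolutelyContinuousOnInterval_intervalIntegral Set.left_mem_uIcc).mono
      (c := s) (d := t) (by
        rw [Set.uIcc_of_le hst, Set.uIcc_of_le (hs.trans hst)]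
        exact Set.Icc_subset_Icc_left hs)
  have h2 : AbsolutelyContinuousOnInterval (fun _ : ℝ => ε) s t :=
    ContDiffOn.absolutelyContinuousOnInterval contDiffOn_const
  exact h2.fun_add h1

theorem mem_uIcc_nonneg {s t τ : ℝ} (hs : 0 ≤ s) (hst : s ≤ t) (hτ : τ ∈ Set.uIcc s t) :
    0 ≤ τ := by
  rw [Set.uIcc_of_le hst] at hτ
  exact hs.trans hτ.1

theorem ac_sqrt_secondMoment (h : IsMarginFlow ℓ a ψ q L ε w g) (j : Fin p) {s t : ℝ}
    (hs : 0 ≤ s) (hst : s ≤ t) :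
    AbsolutelyContinuousOnInterval (fun τ => √(secondMoment ε g j τ)) s t :=
  (h.ac_secondMoment j hs hst).comp_of_hasStrictDerivAt (Φ := Real.sqrt) fun _ hτ =>
    Real.hasStrictDerivAt_sqrt (h.secondMoment_pos j (mem_uIcc_nonneg hs hst hτ)).ne'

theorem ac_logConditioner (h : IsMarginFlow ℓ a ψ q L ε w g) {s t : ℝ}
    (hs : 0 ≤ s) (hst : s ≤ t) :
    AbsolutelyContinuousOnInterval (logConditioner ε g) s t :=
  (AbsolutelyContinuousOnInterval.finset_sum _ fun j _ =>
    (h.ac_secondMoment j hs hst).comp_of_hasStrictDerivAt (Φ := Real.log) fun _ hτ =>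
      Real.hasStrictDerivAt_log (h.secondMoment_pos j (mem_uIcc_nonneg hs hst hτ)).ne').const_mul _

theorem ac_lossAlong (h : IsMarginFlow ℓ a ψ q L ε w g) {s t : ℝ}
    (hs : 0 ≤ s) (hst : s ≤ t) : AbsolutelyContinuousOnInterval (lossAlong ℓ q w) s t :=
  AbsolutelyContinuousOnInterval.finset_sum _ fun i _ =>
    ((h.lip i).comp_absolutelyContinuousOnInterval
      (h.ac_flow hs hst)).comp_of_hasStrictDerivAt (Φ := ℓ) fun _ _ => h.loss.hasStrictDerivAt _

theorem ac_adaptiveSqNorm (h : IsMarginFlow ℓ a ψ q L ε w g) {s t : ℝ}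
    (hs : 0 ≤ s) (hst : s ≤ t) : AbsolutelyContinuousOnInterval (adaptiveSqNorm ε g w) s t := by
  refine AbsolutelyContinuousOnInterval.finset_sum _ fun j _ => ?_
  have h1 := (h.ac_flow hs hst).apply j
  simp only [pow_two]
  exact (h1.fun_mul h1).fun_mul (h.ac_sqrt_secondMoment j hs hst)

/-- Monotonicity along the flow can be checked at regular times. -/
theorem le_of_isRegularTime (h : IsMarginFlow ℓ a ψ q L ε w g) {z : ℝ → ℝ} {s t : ℝ}
    (hz : AbsolutelyContinuousOnInterval z s t) (hs : 0 ≤ s) (hst : s ≤ t)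
    (H : ∀ τ ∈ Set.Ioo s t, ∀ ξ, IsRegularTime a q ε w g τ ξ → ∃ c, 0 ≤ c ∧ HasDerivAt z c τ) :
    z s ≤ z t := by
  refine hz.le_of_ae_hasDerivAt_nonneg hst ?_
  filter_upwards [h.ae_isRegularTime] with τ h1 hτ
  obtain ⟨ξ, hξ⟩ := h1 (hs.trans_lt hτ.1)
  exact H τ hτ ξ hξ

theorem lossAlong_anti (h : IsMarginFlow ℓ a ψ q L ε w g) {s t : ℝ} (hs : 0 ≤ s) (hst : s ≤ t) :
    lossAlong ℓ q w t ≤ lossAlong ℓ q w s := by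
  have := h.le_of_isRegularTime (h.ac_lossAlong hs hst).fun_neg hs hst fun τ _ ξ hξ =>
    ⟨_, dissipation_nonneg ε g τ, by simpa using (h.hasDerivAt_lossAlong hξ).fun_neg⟩
  linarith

/-- The conditioner stays bounded, because the loss pays for its growth. -/
theorem exists_sqrt_secondMoment_le (h : IsMarginFlow ℓ a ψ q L ε w g) :
    ∃ C, 0 < C ∧ ∀ t, 0 ≤ t → ∀ j, √(secondMoment ε g j t) ≤ C := by
  -- The quantity `Λ + 2 ∑ √S_j` is in fact conserved; one inequality suffices.
  have key : ∀ t, 0 ≤ t → -(lossAlong ℓ q w 0 + 2 * ∑ j, √(secondMoment ε g j 0)) ≤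
      -(lossAlong ℓ q w t + 2 * ∑ j, √(secondMoment ε g j t)) := by
    intro t ht
    refine h.le_of_isRegularTime
      (z := fun t => -(lossAlong ℓ q w t + 2 * ∑ j, √(secondMoment ε g j t)))
      ((h.ac_lossAlong le_rfl ht).fun_add ((AbsolutelyContinuousOnInterval.finset_sum _
        fun j _ => h.ac_sqrt_secondMoment j le_rfl ht).const_mul 2)).fun_neg le_rfl ht ?_
    intro τ _ ξ hξ
    refine ⟨_, le_rfl, (((h.hasDerivAt_lossAlong hξ).fun_add
      ((HasDerivAt.fun_sum (u := Finset.univ) fun j _ =>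
        h.hasDerivAt_sqrt_secondMoment hξ j).const_mul 2)).fun_neg).congr_deriv ?_⟩
    rw [dissipation, Finset.mul_sum, neg_eq_zero, neg_add_eq_zero]
    refine Finset.sum_congr rfl fun j _ => ?_
    have := Real.sqrt_pos.2 (h.secondMoment_pos j hξ.pos.le)
    field_simp
  refine ⟨lossAlong ℓ q w 0 + ∑ j, √(secondMoment ε g j 0), ?_, fun t ht j => ?_⟩
  · exact add_pos_of_pos_of_nonneg (h.lossAlong_pos 0) (Finset.sum_nonneg fun j _ => by positivity)
  · have h1 := key t ht
    have h2 := h.lossAlong_pos t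
    have h3 := h.lossAlong_pos 0
    have h4 : √(secondMoment ε g j t) ≤ ∑ j, √(secondMoment ε g j t) :=
      Finset.single_le_sum (f := fun j => √(secondMoment ε g j t)) (fun k _ => by positivity)
        (Finset.mem_univ j)
    linarith

theorem exists_tendsto_adagradConditioner (h : IsMarginFlow ℓ a ψ q L ε w g) :
    ∃ hInf : Param p, Tendsto (adagradConditioner ε g) atTop (𝓝 hInf) ∧ ∀ j, 0 < hInf j := by
  obtain ⟨C, hC0, hC⟩ := h.exists_sqrt_secondMoment_le
  have h1 : ∀ j, ∃ l, Tendsto (fun t => √(secondMoment ε g j t)) atTop (𝓝 l) ∧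
      ∀ t, 0 ≤ t → √(secondMoment ε g j t) ≤ l := fun j =>
    exists_tendsto_of_monotoneOn_Ici
      (fun s t hs hst => Real.sqrt_le_sqrt (h.secondMoment_mono j hs hst))
      (fun t ht => hC t ht j)
  choose l hl hl2 using h1
  have hpos : ∀ j, 0 < l j := fun j =>
    (Real.sqrt_pos.2 (h.secondMoment_pos j le_rfl)).trans_le (hl2 j 0 le_rfl)
  refine ⟨WithLp.toLp 2 fun j => (l j)⁻¹, ?_, fun j => inv_pos.2 (hpos j)⟩
  have h2 : Tendsto (fun t => fun j => (√(secondMoment ε g j t))⁻¹) atTop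
      (𝓝 fun j => (l j)⁻¹) :=
    tendsto_pi_nhds.2 fun j => (hl j).inv₀ (hpos j).ne'
  exact ((PiLp.continuous_toLp 2 (fun _ : Fin p => ℝ)).tendsto _).comp h2

theorem exists_logConditioner_le (h : IsMarginFlow ℓ a ψ q L ε w g) :
    ∃ C, ∀ t, 0 ≤ t → logConditioner ε g t ≤ C := by
  obtain ⟨C, hC0, hC⟩ := h.exists_sqrt_secondMoment_le
  refine ⟨1 / 4 * ∑ _j : Fin p, Real.log (C ^ 2), fun t ht => ?_⟩
  unfold logConditioner
  gcongr with j _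
  · exact h.secondMoment_pos j ht
  · exact (Real.sqrt_le_left hC0.le).1 (hC t ht j)

theorem logConditioner_mono (h : IsMarginFlow ℓ a ψ q L ε w g) {s t : ℝ} (hs : 0 ≤ s)
    (hst : s ≤ t) : logConditioner ε g s ≤ logConditioner ε g t := by
  unfold logConditioner
  gcongr with j _
  · exact h.secondMoment_pos j hs
  · exact h.secondMoment_mono j hs hst

variable {t₀ : ℝ}

theorem inv_loss_mono (h : IsMarginFlow ℓ a ψ q L ε w g) {s t : ℝ} (hs : 0 ≤ s) (hst : s ≤ t) :
    ψ (lossAlong ℓ q w s) ≤ ψ (lossAlong ℓ q w t) := by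
  refine h.loss.inv_le_of_le (h.lossAlong_pos s) ?_
  rw [h.loss.right_inv _ (h.lossAlong_pos t)]
  exact h.lossAlong_anti hs hst

theorem inv_loss_pos (h : IsMarginFlow ℓ a ψ q L ε w g) (h0 : 0 ≤ t₀)
    (hψ : 0 < ψ (lossAlong ℓ q w t₀)) {t : ℝ} (ht : t₀ ≤ t) : 0 < ψ (lossAlong ℓ q w t) :=
  hψ.trans_le (h.inv_loss_mono h0 ht)

theorem ac_logAdaptiveNorm (h : IsMarginFlow ℓ a ψ q L ε w g) (h0 : 0 ≤ t₀)
    (hψ : 0 < ψ (lossAlong ℓ q w t₀)) {s t : ℝ} (hs : t₀ ≤ s) (hst : s ≤ t) :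
    AbsolutelyContinuousOnInterval (logAdaptiveNorm ε g w) s t := by
  refine ((h.ac_adaptiveSqNorm (h0.trans hs) hst).comp_of_hasStrictDerivAt (Φ := Real.log)
    fun τ hτ => Real.hasStrictDerivAt_log ?_).const_mul _
  rw [Set.uIcc_of_le hst] at hτ
  have h1 : t₀ ≤ τ := hs.trans hτ.1
  exact (h.adaptiveSqNorm_pos (h0.trans h1) (h.inv_loss_pos h0 hψ h1)).ne'

theorem ac_logSurrogateMargin (h : IsMarginFlow ℓ a ψ q L ε w g) (h0 : 0 ≤ t₀)
    (hψ : 0 < ψ (lossAlong ℓ q w t₀)) {s t : ℝ} (hs : t₀ ≤ s) (hst : s ≤ t) :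
    AbsolutelyContinuousOnInterval (logSurrogateMargin ℓ ψ q L ε g w) s t := by
  have h1 : AbsolutelyContinuousOnInterval (fun τ => ψ (lossAlong ℓ q w τ)) s t :=
    (h.ac_lossAlong (h0.trans hs) hst).comp_of_hasStrictDerivAt fun τ _ =>
      h.loss.inv_hasStrictDerivAt _ (h.lossAlong_pos τ)
  have h2 : AbsolutelyContinuousOnInterval (fun τ => Real.log (ψ (lossAlong ℓ q w τ))) s t := by
    refine h1.comp_of_hasStrictDerivAt fun τ hτ => Real.hasStrictDerivAt_log ?_
    rw [Set.uIcc_of_le hst] at hτ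
    exact (h.inv_loss_pos h0 hψ (hs.trans hτ.1)).ne'
  exact (h2.fun_sub ((h.ac_logAdaptiveNorm h0 hψ hs hst).const_mul L)).fun_add
    ((h.ac_logConditioner (h0.trans hs) hst).const_mul L)

theorem logSurrogateMargin_mono (h : IsMarginFlow ℓ a ψ q L ε w g) (h0 : 0 ≤ t₀)
    (hψ : 0 < ψ (lossAlong ℓ q w t₀)) {s t : ℝ} (hs : t₀ ≤ s) (hst : s ≤ t) :
    logSurrogateMargin ℓ ψ q L ε g w s ≤ logSurrogateMargin ℓ ψ q L ε g w t := by
  refine h.le_of_isRegularTime (h.ac_logSurrogateMargin h0 hψ hs hst) (h0.trans hs) hst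
    fun τ hτ ξ hξ => ?_
  have hψτ := h.inv_loss_pos h0 hψ (hs.trans hτ.1.le)
  obtain ⟨c, hc, hle⟩ := h.hasDerivAt_logSurrogateMargin hξ hψτ
  refine ⟨c, le_trans (mul_nonneg h.order_pos.le ?_) hle, hc⟩
  rw [sub_nonneg, div_le_div_iff₀ (h.adaptiveSqNorm_pos hξ.pos.le hψτ) (h.weightedMargin_pos hψτ)]
  nlinarith [h.weightedMargin_sq_le hξ]

theorem logAdaptiveNorm_mono (h : IsMarginFlow ℓ a ψ q L ε w g) (h0 : 0 ≤ t₀)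
    (hψ : 0 < ψ (lossAlong ℓ q w t₀)) {s t : ℝ} (hs : t₀ ≤ s) (hst : s ≤ t) :
    logAdaptiveNorm ε g w s ≤ logAdaptiveNorm ε g w t := by
  refine h.le_of_isRegularTime (h.ac_logAdaptiveNorm h0 hψ hs hst) (h0.trans hs) hst
    fun τ hτ ξ hξ => ?_
  have hψτ := h.inv_loss_pos h0 hψ (hs.trans hτ.1.le)
  have hR := h.adaptiveSqNorm_pos hξ.pos.le hψτ
  obtain ⟨c, hc, hle, -⟩ := h.hasDerivAt_logAdaptiveNorm hξ hR
  exact ⟨c, le_trans (div_pos (h.weightedMargin_pos hψτ) hR).le hle, hc⟩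

theorem log_norm_le_logAdaptiveNorm (h : IsMarginFlow ℓ a ψ q L ε w g) {t : ℝ} (ht : 0 ≤ t)
    (hψ : 0 < ψ (lossAlong ℓ q w t)) :
    1 / 2 * Real.log √ε + Real.log ‖w t‖ ≤ logAdaptiveNorm ε g w t := by
  have h1 := norm_pos_iff.2 (h.ne_zero hψ)
  have h2 := Real.sqrt_pos.2 h.eps_pos
  have h3 := Real.log_le_log (by positivity) (h.sqrt_eps_mul_le_adaptiveSqNorm ht)
  rw [Real.log_mul h2.ne' (by positivity), Real.log_pow] at h3
  push_cast at h3
  unfold logAdaptiveNorm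
  linarith

/-- All margins grow at least as fast as `‖w‖ ^ L`. -/
theorem exists_mul_rpow_le_margin (h : IsMarginFlow ℓ a ψ q L ε w g) (h0 : 0 ≤ t₀)
    (hψ : 0 < ψ (lossAlong ℓ q w t₀)) :
    ∃ c, 0 < c ∧ ∀ t, t₀ ≤ t → ∀ i, c * ‖w t‖ ^ L ≤ q i (w t) := by
  obtain ⟨C, hC⟩ := h.exists_logConditioner_le
  -- Solve `Γ(t) ≥ Γ(t₀)` for `ψ(Λ)`, with `H ≤ C` and `R ≥ √ε ‖w‖²`.
  refine ⟨Real.exp (logSurrogateMargin ℓ ψ q L ε g w t₀ + L * (1 / 2 * Real.log √ε) - L * C),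
    Real.exp_pos _, fun t ht i => ?_⟩
  have hψt := h.inv_loss_pos h0 hψ ht
  have h1 := norm_pos_iff.2 (h.ne_zero hψt)
  refine le_trans ?_ (h.loss.inv_le_of_sum (fun i => q i (w t)) i)
  change _ ≤ ψ (lossAlong ℓ q w t)
  rw [← Real.exp_log h1, ← Real.exp_mul, ← Real.exp_add, ← Real.le_log_iff_exp_le hψt]
  have h2 := h.logSurrogateMargin_mono h0 hψ le_rfl ht
  conv_rhs at h2 => unfold logSurrogateMargin
  have h3 := mul_le_mul_of_nonneg_left (hC t (h0.trans ht)) h.order_pos.le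
  have h4 := mul_le_mul_of_nonneg_left (h.log_norm_le_logAdaptiveNorm (h0.trans ht) hψt)
    h.order_pos.le
  rw [mul_add] at h4
  linarith

theorem exists_log_inv_loss_le (h : IsMarginFlow ℓ a ψ q L ε w g) (h0 : 0 ≤ t₀)
    (hψ : 0 < ψ (lossAlong ℓ q w t₀)) :
    ∃ C, ∀ t, t₀ ≤ t → Real.log (ψ (lossAlong ℓ q w t)) ≤ C + L * logAdaptiveNorm ε g w t := by
  obtain ⟨i⟩ := h.nonempty
  obtain ⟨M, hM, hMq⟩ := exists_le_mul_norm_rpow (h.lip i).continuous (h.hom i)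
  refine ⟨Real.log M - L * (1 / 2 * Real.log √ε), fun t ht => ?_⟩
  have hψt := h.inv_loss_pos h0 hψ ht
  have h1 := norm_pos_iff.2 (h.ne_zero hψt)
  have h2 := Real.log_le_log hψt ((h.loss.inv_le_of_sum (fun i => q i (w t)) i).trans
    (hMq _ (h.ne_zero hψt)))
  rw [Real.log_mul hM.ne' (by positivity), Real.log_rpow h1] at h2
  have h4 := mul_le_mul_of_nonneg_left (h.log_norm_le_logAdaptiveNorm (h0.trans ht) hψt)
    h.order_pos.le
  rw [mul_add] at h4
  linarith

theorem exists_logSurrogateMargin_le (h : IsMarginFlow ℓ a ψ q L ε w g) (h0 : 0 ≤ t₀)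
    (hψ : 0 < ψ (lossAlong ℓ q w t₀)) :
    ∃ C, ∀ t, t₀ ≤ t → logSurrogateMargin ℓ ψ q L ε g w t ≤ C := by
  obtain ⟨C, hC⟩ := h.exists_logConditioner_le
  obtain ⟨B, hB⟩ := h.exists_log_inv_loss_le h0 hψ
  refine ⟨B + L * C, fun t ht => ?_⟩
  have h3 := mul_le_mul_of_nonneg_left (hC t (h0.trans ht)) h.order_pos.le
  have h4 := hB t ht
  unfold logSurrogateMargin
  linarith

/-- The loss becomes arbitrarily small. -/
theorem exists_lossAlong_lt (h : IsMarginFlow ℓ a ψ q L ε w g) (h0 : 0 ≤ t₀)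
    (hψ : 0 < ψ (lossAlong ℓ q w t₀)) {δ : ℝ} (hδ : 0 < δ) :
    ∃ t, t₀ ≤ t ∧ lossAlong ℓ q w t < δ := by
  by_contra! hcon
  obtain ⟨C, hC⟩ := h.exists_logConditioner_le
  set Λ₀ := lossAlong ℓ q w t₀ with hΛ₀
  have hΛ₀pos : 0 < Λ₀ := h.lossAlong_pos t₀
  -- If `Λ ≥ δ` forever, monotonicity of `x a(x) / ℓ(x)` keeps `ν` above this constant.
  set κ := L * (a (ψ Λ₀) * ψ Λ₀ * δ / Λ₀) with hκ
  have hκpos : 0 < κ := by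
    have := h.loss.slope_pos (ψ Λ₀)
    have := h.order_pos
    positivity
  have hν : ∀ t, t₀ ≤ t → κ ≤ weightedMargin a q L w t := by
    intro t ht
    refine le_trans ?_ (h.slope_mul_le_weightedMargin (h.inv_loss_pos h0 hψ ht))
    refine mul_le_mul_of_nonneg_left ?_ h.order_pos.le
    rw [div_le_iff₀ hΛ₀pos]
    have h1 := h.loss.mul_slope_mono _ _ hψ (h.inv_loss_mono h0 ht)
    rw [h.loss.right_inv _ hΛ₀pos, h.loss.right_inv _ (h.lossAlong_pos t)] at h1
    refine le_trans ?_ h1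
    exact mul_le_mul_of_nonneg_left (hcon t ht) (mul_pos (h.loss.slope_pos _) hψ).le
  -- `ψ(Λ) ≤ ψ(δ)`, `H ≤ C` and `Γ ≥ Γ(t₀)` together bound `R = e^{2ρ}`.
  set B := Real.exp (2 / L * (Real.log (ψ δ) - logSurrogateMargin ℓ ψ q L ε g w t₀ + L * C))
    with hB
  have hR : ∀ t, t₀ ≤ t → adaptiveSqNorm ε g w t ≤ B := by
    intro t ht
    have hψt := h.inv_loss_pos h0 hψ ht
    rw [hB, ← Real.log_le_iff_le_exp (h.adaptiveSqNorm_pos (h0.trans ht) hψt)]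
    have h2 := h.logSurrogateMargin_mono h0 hψ le_rfl ht
    conv_rhs at h2 => unfold logSurrogateMargin
    have h3 := mul_le_mul_of_nonneg_left (hC t (h0.trans ht)) h.order_pos.le
    have h4 : ψ (lossAlong ℓ q w t) ≤ ψ δ := by
      refine h.loss.inv_le_of_le (h.lossAlong_pos t) ?_
      rw [h.loss.right_inv _ hδ]
      exact hcon t ht
    have h5 := Real.log_le_log hψt h4
    unfold logAdaptiveNorm at h2
    rw [div_mul_eq_mul_div, le_div_iff₀ h.order_pos]
    linarith
  have hBpos : 0 < B := Real.exp_pos _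
  have hA : ∀ t, t₀ ≤ t → ∀ ξ, IsRegularTime a q ε w g t ξ → κ ^ 2 / B ≤ dissipation ε g t := by
    intro t ht ξ hξ
    rw [div_le_iff₀ hBpos]
    calc κ ^ 2 ≤ weightedMargin a q L w t ^ 2 := pow_le_pow_left₀ hκpos.le (hν t ht) 2
      _ ≤ _ := h.weightedMargin_sq_le hξ
      _ ≤ _ := mul_le_mul_of_nonneg_left (hR t ht) (dissipation_nonneg _ _ _)
  -- Since `A ≥ ν² / R ≥ κ² / B`, the loss would be used up by time `t₀ + T`, although it is always
  -- positive.
  set T := Λ₀ / (κ ^ 2 / B) with hT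
  have hTpos : 0 < T := by positivity
  have hle : t₀ ≤ t₀ + T := by linarith
  have hlin : AbsolutelyContinuousOnInterval (fun t : ℝ => κ ^ 2 / B * t) t₀ (t₀ + T) :=
    ContDiffOn.absolutelyContinuousOnInterval (by fun_prop)
  have hfin := h.le_of_isRegularTime ((h.ac_lossAlong h0 hle).fun_add hlin).fun_neg h0 hle
    fun τ hτ ξ hξ => ⟨dissipation ε g τ - κ ^ 2 / B, sub_nonneg.2 (hA τ hτ.1.le ξ hξ),
      (((h.hasDerivAt_lossAlong hξ).fun_add
        ((hasDerivAt_id τ).const_mul (κ ^ 2 / B))).fun_neg).congr_deriv (by simp; ring)⟩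
  have h1 : κ ^ 2 / B * T = Λ₀ := by
    rw [hT]
    field_simp
  have h2 := h.lossAlong_pos (t₀ + T)
  rw [mul_add] at hfin
  linarith

theorem tendsto_inv_loss_atTop (h : IsMarginFlow ℓ a ψ q L ε w g) (h0 : 0 ≤ t₀)
    (hψ : 0 < ψ (lossAlong ℓ q w t₀)) :
    Tendsto (fun t => ψ (lossAlong ℓ q w t)) atTop atTop := by
  refine tendsto_atTop.2 fun b => ?_
  obtain ⟨s, hs, hlt⟩ := h.exists_lossAlong_lt h0 hψ (h.loss.pos b)
  filter_upwards [eventually_ge_atTop s] with t ht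
  exact (h.loss.lt_inv_of_lt (h.lossAlong_pos s) hlt).le.trans
    (h.inv_loss_mono (h0.trans hs) ht)

theorem tendsto_logAdaptiveNorm_atTop (h : IsMarginFlow ℓ a ψ q L ε w g) (h0 : 0 ≤ t₀)
    (hψ : 0 < ψ (lossAlong ℓ q w t₀)) : Tendsto (logAdaptiveNorm ε g w) atTop atTop := by
  obtain ⟨C, hC⟩ := h.exists_log_inv_loss_le h0 hψ
  have h1 : Tendsto (fun t => (Real.log (ψ (lossAlong ℓ q w t)) - C) / L) atTop atTop :=
    (tendsto_atTop_add_const_right _ (-C)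
      (Real.tendsto_log_atTop.comp (h.tendsto_inv_loss_atTop h0 hψ))).atTop_div_const h.order_pos
  refine tendsto_atTop_mono' _ ?_ h1
  filter_upwards [eventually_ge_atTop t₀] with t ht
  rw [div_le_iff₀ h.order_pos]
  linarith [hC t ht]

end IsMarginFlow

end

/-! ### Motion of the direction and almost aligned times. -/

noncomputable section

namespace IsMarginFlow

variable {p N : ℕ} {ℓ a ψ : ℝ → ℝ} {q : Fin N → Param p → ℝ} {L ε : ℝ} {w g : ℝ → Param p}
  {t₀ : ℝ}

theorem exists_adaptiveSqNorm_le (h : IsMarginFlow ℓ a ψ q L ε w g) :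
    ∃ C, 0 < C ∧ ∀ t, 0 ≤ t → adaptiveSqNorm ε g w t ≤ C * ‖w t‖ ^ 2 := by
  obtain ⟨C, hC0, hC⟩ := h.exists_sqrt_secondMoment_le
  refine ⟨C, hC0, fun t ht => ?_⟩
  rw [EuclideanSpace.norm_sq_eq, Finset.mul_sum]
  refine Finset.sum_le_sum fun j _ => ?_
  rw [Real.norm_eq_abs, sq_abs, mul_comm]
  exact mul_le_mul_of_nonneg_right (hC t ht j) (sq_nonneg _)

theorem norm_velocity_le (h : IsMarginFlow ℓ a ψ q L ε w g) {t : ℝ} (ht : 0 ≤ t) :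
    ‖hadamard (adagradConditioner ε g t) (g t)‖ ≤ (√ε)⁻¹ * ‖g t‖ := by
  have hε := Real.sqrt_pos.2 h.eps_pos
  refine le_of_sq_le_sq ?_ (by positivity)
  rw [mul_pow, EuclideanSpace.norm_sq_eq, EuclideanSpace.norm_sq_eq, Finset.mul_sum]
  refine Finset.sum_le_sum fun j _ => ?_
  simp only [hadamard, norm_mul, mul_pow]
  gcongr
  change ‖(√(secondMoment ε g j t))⁻¹‖ ≤ _
  rw [Real.norm_eq_abs, abs_of_nonneg (by positivity)]
  gcongr
  exact h.eps_le_secondMoment j ht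

/-- The relative speed of the flow is controlled by the growth of its norm. -/
theorem exists_norm_velocity_le (h : IsMarginFlow ℓ a ψ q L ε w g) (h0 : 0 ≤ t₀)
    (hψ : 0 < ψ (lossAlong ℓ q w t₀)) :
    ∃ C, 0 ≤ C ∧ ∀ t, t₀ ≤ t → ∀ ξ, IsRegularTime a q ε w g t ξ →
      ‖hadamard (adagradConditioner ε g t) (g t)‖ ≤
        C * ‖w t‖ * (weightedMargin a q L w t / adaptiveSqNorm ε g w t) := by
  obtain ⟨c, hc, hcq⟩ := h.exists_mul_rpow_le_margin h0 hψ
  obtain ⟨B, hB, hBR⟩ := h.exists_adaptiveSqNorm_le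
  choose K hK0 hK using fun i => exists_norm_clarkeSubdiff_le (h.lip i) (h.hom i)
  have hε := Real.sqrt_pos.2 h.eps_pos
  have hL := h.order_pos
  have hKs : 0 ≤ ∑ i, K i := Finset.sum_nonneg fun i _ => hK0 i
  -- The factors come from `h ≤ 1 / √ε`, `‖g‖ ≤ (∑ K) ‖w‖ ^ (L - 1) ∑ a`, `ν ≥ L c ‖w‖ ^ L ∑ a` and
  -- `R ≤ B ‖w‖²`.
  refine ⟨(√ε)⁻¹ * (∑ i, K i) / (L * c) * B, by positivity, fun t ht ξ hξ => ?_⟩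
  have hψt := h.inv_loss_pos h0 hψ ht
  have hw := h.ne_zero hψt
  have hn := norm_pos_iff.2 hw
  have hR := h.adaptiveSqNorm_pos hξ.pos.le hψt
  have hν := h.weightedMargin_pos hψt
  have h1 : ‖g t‖ ≤ (∑ i, K i) * ‖w t‖ ^ (L - 1) * ∑ i, a (q i (w t)) := by
    rw [hξ.grad, norm_neg, Finset.mul_sum]
    refine norm_sum_le_of_le _ fun i _ => ?_
    rw [norm_smul, Real.norm_eq_abs, abs_of_pos (h.loss.slope_pos _), mul_comm]
    refine mul_le_mul_of_nonneg_right ((hK i _ hw _ (hξ.mem i)).trans ?_) (h.loss.slope_pos _).le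
    exact mul_le_mul_of_nonneg_right (Finset.single_le_sum (fun i _ => hK0 i) (Finset.mem_univ i))
      (by positivity)
  have h2 : L * (c * ‖w t‖ ^ L * ∑ i, a (q i (w t))) ≤ weightedMargin a q L w t := by
    unfold weightedMargin
    rw [Finset.mul_sum]
    refine mul_le_mul_of_nonneg_left (Finset.sum_le_sum fun i _ => ?_) hL.le
    rw [mul_comm]
    exact mul_le_mul_of_nonneg_left (hcq t ht i) (h.loss.slope_pos _).le
  have h3 : ‖w t‖ ^ (L - 1) = ‖w t‖ ^ L / ‖w t‖ := Real.rpow_sub_one hn.ne' L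
  have h4 : ‖w t‖ ^ (L - 1) * ∑ i, a (q i (w t)) ≤ weightedMargin a q L w t / (L * c) / ‖w t‖ := by
    rw [h3, div_mul_eq_mul_div]
    gcongr
    rw [le_div_iff₀ (by positivity)]
    linarith
  have h5 : weightedMargin a q L w t / ‖w t‖ ≤
      B * ‖w t‖ * (weightedMargin a q L w t / adaptiveSqNorm ε g w t) := by
    rw [← mul_div_assoc, div_le_div_iff₀ hn hR]
    have := mul_le_mul_of_nonneg_left (hBR t hξ.pos.le) hν.le
    linarith
  calc ‖hadamard (adagradConditioner ε g t) (g t)‖ ≤ (√ε)⁻¹ * ‖g t‖ := h.norm_velocity_le hξ.pos.le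
    _ ≤ (√ε)⁻¹ * ((∑ i, K i) * ‖w t‖ ^ (L - 1) * ∑ i, a (q i (w t))) := by gcongr
    _ = (√ε)⁻¹ * (∑ i, K i) * (‖w t‖ ^ (L - 1) * ∑ i, a (q i (w t))) := by ring
    _ ≤ (√ε)⁻¹ * (∑ i, K i) * (weightedMargin a q L w t / (L * c) / ‖w t‖) := by gcongr
    _ = (√ε)⁻¹ * (∑ i, K i) / (L * c) * (weightedMargin a q L w t / ‖w t‖) := by field_simp
    _ ≤ (√ε)⁻¹ * (∑ i, K i) / (L * c) *
        (B * ‖w t‖ * (weightedMargin a q L w t / adaptiveSqNorm ε g w t)) := by gcongr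
    _ = _ := by ring

/-- The derivative of the component of `w / ‖w‖` in a fixed direction. -/
theorem exists_hasDerivAt_direction {z : ℝ → Param p} {v d : Param p} {t : ℝ}
    (hz : HasDerivAt z v t) (hn : z t ≠ 0) :
    ∃ c, HasDerivAt (fun s => inner ℝ (‖z s‖⁻¹ • z s) d) c t ∧ |c| ≤ 2 * ‖v‖ / ‖z t‖ * ‖d‖ := by
  have hpos := norm_pos_iff.2 hn
  have h1 : HasDerivAt (fun s => ‖z s‖) (inner ℝ (z t) v / ‖z t‖) t := by
    have h2 := hz.norm_sq.sqrt (by positivity)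
    simp only [Real.sqrt_sq (norm_nonneg _)] at h2
    refine h2.congr_deriv ?_
    field_simp
  have h3 : HasDerivAt (fun s => inner ℝ (z s) d) (inner ℝ v d) t := by
    simpa using hz.inner ℝ (hasDerivAt_const t d)
  simp only [real_inner_smul_left]
  refine ⟨_, (h1.fun_inv hpos.ne').fun_mul h3, ?_⟩
  have h4 := abs_real_inner_le_norm (z t) v
  have h5 := abs_real_inner_le_norm (z t) d
  have h6 := abs_real_inner_le_norm v d
  refine (abs_add_le _ _).trans ?_
  rw [abs_mul, abs_mul, abs_div, abs_neg, abs_div, abs_inv, abs_pow, abs_norm]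
  calc |inner ℝ (z t) v| / ‖z t‖ / ‖z t‖ ^ 2 * |inner ℝ (z t) d| + ‖z t‖⁻¹ * |inner ℝ v d|
      ≤ ‖z t‖ * ‖v‖ / ‖z t‖ / ‖z t‖ ^ 2 * (‖z t‖ * ‖d‖) + ‖z t‖⁻¹ * (‖v‖ * ‖d‖) := by gcongr
    _ = _ := by
      field_simp
      ring

theorem ac_direction (h : IsMarginFlow ℓ a ψ q L ε w g) (h0 : 0 ≤ t₀)
    (hψ : 0 < ψ (lossAlong ℓ q w t₀)) {s t : ℝ} (hs : t₀ ≤ s) (hst : s ≤ t) (d : Param p) :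
    AbsolutelyContinuousOnInterval (fun τ => inner ℝ (‖w τ‖⁻¹ • w τ) d) s t := by
  refine LocallyLipschitzOn.comp_absolutelyContinuousOnInterval
    (Φ := fun x : Param p => inner ℝ (‖x‖⁻¹ • x) d) (U := {0}ᶜ) (fun x hx => ?_)
    (h.ac_flow (h0.trans hs) hst) fun τ hτ => ?_
  · have h1 : ContDiffAt ℝ 1 (fun x : Param p => inner ℝ (‖x‖⁻¹ • x) d) x := by
      have hx' : ‖x‖ ≠ 0 := norm_ne_zero_iff.2 hx
      exact (((contDiffAt_norm ℝ hx).inv hx').smul contDiffAt_id).inner ℝ contDiffAt_const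
    obtain ⟨K, s, hs, hK⟩ := h1.exists_lipschitzOnWith
    exact ⟨K, s, mem_nhdsWithin_of_mem_nhds hs, hK⟩
  · rw [Set.uIcc_of_le hst] at hτ
    exact h.ne_zero (h.inv_loss_pos h0 hψ (hs.trans hτ.1))

/-- The direction of the flow moves at most as fast as the logarithm of its norm. -/
theorem exists_norm_direction_sub_le (h : IsMarginFlow ℓ a ψ q L ε w g) (h0 : 0 ≤ t₀)
    (hψ : 0 < ψ (lossAlong ℓ q w t₀)) :
    ∃ C, 0 < C ∧ ∀ s t, t₀ ≤ s → s ≤ t →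
      ‖‖w t‖⁻¹ • w t - ‖w s‖⁻¹ • w s‖ ≤
        C * (logAdaptiveNorm ε g w t - logAdaptiveNorm ε g w s) := by
  obtain ⟨C, hC0, hC⟩ := h.exists_norm_velocity_le h0 hψ
  refine ⟨2 * C + 1, by positivity, fun s t hs hst => ?_⟩
  -- Testing the displacement against itself reduces the vector bound to monotonicity of a scalar
  -- function.
  set d := ‖w t‖⁻¹ • w t - ‖w s‖⁻¹ • w s with hd
  have h1 := h.le_of_isRegularTime
    (((h.ac_logAdaptiveNorm h0 hψ hs hst).const_mul ((2 * C + 1) * ‖d‖)).fun_sub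
      (h.ac_direction h0 hψ hs hst d)) (h0.trans hs) hst fun τ hτ ξ hξ => by
    have hτ0 := hs.trans hτ.1.le
    have hψτ := h.inv_loss_pos h0 hψ hτ0
    have hn := norm_pos_iff.2 (h.ne_zero hψτ)
    have hR := h.adaptiveSqNorm_pos hξ.pos.le hψτ
    obtain ⟨c, hc, hcle, -⟩ := h.hasDerivAt_logAdaptiveNorm hξ hR
    obtain ⟨e, he, hele⟩ := exists_hasDerivAt_direction (d := d) hξ.deriv (h.ne_zero hψτ)
    refine ⟨_, ?_, (hc.const_mul _).fun_sub he⟩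
    have h2 := hC τ hτ0 ξ hξ
    rw [norm_neg] at hele
    have hq : 0 < weightedMargin a q L w τ / adaptiveSqNorm ε g w τ :=
      div_pos (h.weightedMargin_pos hψτ) hR
    have h3 : 2 * ‖hadamard (adagradConditioner ε g τ) (g τ)‖ / ‖w τ‖ ≤ (2 * C + 1) * c := by
      rw [div_le_iff₀ hn]
      calc _ ≤ 2 * (C * ‖w τ‖ * (weightedMargin a q L w τ / adaptiveSqNorm ε g w τ)) := by gcongr
        _ ≤ 2 * (C * ‖w τ‖ * c) := by gcongr
        _ ≤ (2 * C + 1) * c * ‖w τ‖ := by nlinarith [mul_pos (hq.trans_le hcle) hn]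
    have h4 := mul_le_mul_of_nonneg_right h3 (norm_nonneg d)
    have h5 := (le_abs_self e).trans hele
    linarith
  have h2 : inner ℝ (‖w t‖⁻¹ • w t) d - inner ℝ (‖w s‖⁻¹ • w s) d = ‖d‖ ^ 2 := by
    rw [← inner_sub_left, ← hd, real_inner_self_eq_norm_sq]
  rcases (norm_nonneg d).eq_or_lt with h3 | h3
  · rw [← h3]
    have := h.logAdaptiveNorm_mono h0 hψ hs hst
    exact mul_nonneg (by positivity) (by linarith)
  · have h4 : ‖d‖ * ‖d‖ ≤
        ‖d‖ * ((2 * C + 1) * (logAdaptiveNorm ε g w t - logAdaptiveNorm ε g w s)) := by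
      nlinarith
    exact le_of_mul_le_mul_left h4 h3

/-- Near every limit direction there are arbitrarily late regular times at which the velocity is
almost aligned with the position. -/
theorem exists_aligned_time (h : IsMarginFlow ℓ a ψ q L ε w g) (h0 : 0 ≤ t₀)
    (hψ : 0 < ψ (lossAlong ℓ q w t₀)) {wBar : Param p}
    (hw : MapClusterPt wBar atTop (fun t : ℝ => ‖w t‖⁻¹ • w t)) {η : ℝ} (hη : 0 < η) (T : ℝ) :
    ∃ t, t₀ ≤ t ∧ T ≤ t ∧ ‖‖w t‖⁻¹ • w t - wBar‖ ≤ η ∧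
      dissipation ε g t * adaptiveSqNorm ε g w t ≤ (1 + η) * weightedMargin a q L w t ^ 2 ∧
      ∃ ξ, IsRegularTime a q ε w g t ξ := by
  obtain ⟨C, hC0, hC⟩ := h.exists_norm_direction_sub_le h0 hψ
  obtain ⟨CΓ, hCΓ⟩ := h.exists_logSurrogateMargin_le h0 hψ
  obtain ⟨CH, hCH⟩ := h.exists_logConditioner_le
  obtain ⟨lΓ, hlΓ, hleΓ⟩ := exists_tendsto_of_monotoneOn_Ici
    (fun s t hs hst => h.logSurrogateMargin_mono h0 hψ hs hst) hCΓ
  obtain ⟨lH, hlH, hleH⟩ := exists_tendsto_of_monotoneOn_Ici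
    (fun s t hs hst => h.logConditioner_mono hs hst) hCH
  have hL := h.order_pos
  -- Growth of `ρ` by `η₁` moves the direction by at most `η / 2`; the other `η / 2` is the starting
  -- distance to `wBar`.
  set η₁ := η / (2 * C) with hη₁
  have hη₁pos : 0 < η₁ := by positivity
  -- The first bound leaves `ρ - H` an increase of at least `3 η₁ / 4`; the second makes the
  -- remaining increase of `Γ` too small to pay for it.
  set δ := min (η₁ / 4) (L * η * η₁ / 4) with hδ
  have hδpos : 0 < δ := by positivity
  have hnear : ∀ᶠ t in atTop, t₀ ≤ t ∧ T ≤ t ∧ lΓ - δ < logSurrogateMargin ℓ ψ q L ε g w t ∧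
      lH - δ < logConditioner ε g t :=
    (eventually_ge_atTop t₀).and ((eventually_ge_atTop T).and
      ((hlΓ.eventually (lt_mem_nhds (by linarith))).and
        (hlH.eventually (lt_mem_nhds (by linarith)))))
  obtain ⟨s, hsball, hs0, hsT, hsΓ, hsH⟩ :=
    ((hw.frequently (Metric.ball_mem_nhds wBar (half_pos hη))).and_eventually hnear).exists
  rw [dist_eq_norm] at hsball
  obtain ⟨b, hb1, hb2⟩ := ((h.tendsto_logAdaptiveNorm_atTop h0 hψ).eventually_ge_atTop
    (logAdaptiveNorm ε g w s + η₁)).and (eventually_ge_atTop s) |>.exists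
  obtain ⟨s', hs'mem, hs'⟩ : ∃ s' ∈ Set.Icc s b,
      logAdaptiveNorm ε g w s' = logAdaptiveNorm ε g w s + η₁ := by
    have hcont := (h.ac_logAdaptiveNorm h0 hψ hs0 hb2).continuousOn
    rw [Set.uIcc_of_le hb2] at hcont
    exact intermediate_value_Icc hb2 hcont ⟨by linarith, hb1⟩
  have hss' := hs'mem.1
  -- Without alignment on the window, `Γ' ≥ L η ν / R ≥ L η (ρ - H)'` there, so `Γ - L η (ρ - H)`
  -- would increase.
  by_contra! hcon
  have hmain := h.le_of_isRegularTime
    ((h.ac_logSurrogateMargin h0 hψ hs0 hss').fun_sub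
      (((h.ac_logAdaptiveNorm h0 hψ hs0 hss').fun_sub
        (h.ac_logConditioner (h0.trans hs0) hss')).const_mul (L * η))) (h0.trans hs0) hss'
    fun τ hτ ξ hξ => by
    have hτ0 := hs0.trans hτ.1.le
    have hψτ := h.inv_loss_pos h0 hψ hτ0
    have hR := h.adaptiveSqNorm_pos hξ.pos.le hψτ
    have hν := h.weightedMargin_pos hψτ
    obtain ⟨c, hc, -, hcle⟩ := h.hasDerivAt_logAdaptiveNorm hξ hR
    obtain ⟨e, he, hele⟩ := h.hasDerivAt_logSurrogateMargin hξ hψτ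
    refine ⟨_, ?_, he.fun_sub ((hc.fun_sub (h.hasDerivAt_logConditioner hξ)).const_mul (L * η))⟩
    have hdir : ‖‖w τ‖⁻¹ • w τ - wBar‖ ≤ η := by
      have h1 := hC s τ hs0 hτ.1.le
      have h2 := h.logAdaptiveNorm_mono h0 hψ hτ0 hτ.2.le
      have h3 : C * (logAdaptiveNorm ε g w τ - logAdaptiveNorm ε g w s) ≤ C * η₁ :=
        mul_le_mul_of_nonneg_left (by linarith) hC0.le
      have h4 : C * η₁ = η / 2 := by
        rw [hη₁]
        field_simp
      have h5 := norm_add_le (‖w τ‖⁻¹ • w τ - ‖w s‖⁻¹ • w s) (‖w s‖⁻¹ • w s - wBar)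
      rw [sub_add_sub_cancel] at h5
      linarith
    have hal : (1 + η) * weightedMargin a q L w τ ^ 2 <
        dissipation ε g τ * adaptiveSqNorm ε g w τ := by
      by_contra! hle
      exact hcon τ hτ0 (hsT.trans hτ.1.le) hdir hle ξ hξ
    have h6 : (1 + η) * (weightedMargin a q L w τ / adaptiveSqNorm ε g w τ) ≤
        dissipation ε g τ / weightedMargin a q L w τ := by
      rw [← mul_div_assoc, div_le_div_iff₀ hR hν]
      linarith
    have h7 : L * η * (c - 1 / 4 * ∑ j, g τ j ^ 2 / secondMoment ε g j τ) ≤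
        L * η * (weightedMargin a q L w τ / adaptiveSqNorm ε g w τ) :=
      mul_le_mul_of_nonneg_left (by linarith) (by positivity)
    have h8 : L * (η * (weightedMargin a q L w τ / adaptiveSqNorm ε g w τ)) ≤
        L * (dissipation ε g τ / weightedMargin a q L w τ -
          weightedMargin a q L w τ / adaptiveSqNorm ε g w τ) :=
      mul_le_mul_of_nonneg_left (by linarith) hL.le
    linarith
  have h1 := hleΓ s' (hs0.trans hss')
  have h2 := hleH s' (h0.trans (hs0.trans hss'))
  have h3 : δ ≤ η₁ / 4 := min_le_left _ _
  have h4 : δ ≤ L * η * η₁ / 4 := min_le_right _ _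
  have h5 : L * η * (η₁ * (3 / 4)) ≤ L * η * (logAdaptiveNorm ε g w s' - logConditioner ε g s' -
      (logAdaptiveNorm ε g w s - logConditioner ε g s)) :=
    mul_le_mul_of_nonneg_left (by linarith) (by positivity)
  have h6 : 0 < L * η * η₁ := by positivity
  linarith

end IsMarginFlow

end

/-! ### KKT conditions at the limit directions. -/

noncomputable section

section WeightedNorm

variable {p : ℕ}

/-- Element-wise multiplication by a fixed vector as a linear map. -/
def hadamardLinearMap (u : Param p) : Param p →ₗ[ℝ] Param p where
  toFun x := hadamard u x
  map_add' x y := by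
    ext j
    simp [hadamard, mul_add]
  map_smul' c x := by
    ext j
    simp [hadamard]
    ring

/-- The gradient of the weighted norm `½ ‖u ⊙ x‖` is a Clarke subgradient. -/
theorem mem_clarkeSubdiff_half_norm_hadamard (u v : Param p) (hv : hadamard u v ≠ 0) :
    (WithLp.toLp 2 fun j => u j ^ 2 * v j / (2 * ‖hadamard u v‖) : Param p) ∈
      clarkeSubdiff (fun x => (1 / 2 : ℝ) * ‖hadamard u x‖) v := by
  set D := LinearMap.toContinuousLinearMap (hadamardLinearMap u) with hD
  have hDx : ∀ x, hadamard u x = D x := fun x => rfl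
  have hlip : LipschitzWith ‖D‖₊ (fun x => (1 / 2 : ℝ) * ‖hadamard u x‖) := by
    refine LipschitzWith.of_dist_le_mul fun x y => ?_
    rw [Real.dist_eq, ← mul_sub, abs_mul, dist_eq_norm, hDx, hDx]
    have h1 := abs_norm_sub_norm_le (D x) (D y)
    rw [← map_sub] at h1
    have h2 := h1.trans (D.le_opNorm (x - y))
    have h3 : |(1 / 2 : ℝ)| = 1 / 2 := abs_of_pos (by norm_num)
    rw [h3]
    have h4 : (0 : ℝ) ≤ ‖D‖ * ‖x - y‖ := by positivity
    simp only [coe_nnnorm]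
    linarith
  intro d
  have hn : 0 < ‖hadamard u v‖ := norm_pos_iff.2 hv
  have hin : inner ℝ (WithLp.toLp 2 fun j => u j ^ 2 * v j / (2 * ‖hadamard u v‖) : Param p) d =
      inner ℝ (D v) (D d) / (2 * ‖D v‖) := by
    rw [← hDx, ← hDx, PiLp.inner_apply, PiLp.inner_apply, Finset.sum_div]
    refine Finset.sum_congr rfl fun j _ => ?_
    simp only [hadamard, RCLike.inner_apply, conj_trivial]
    ring
  rw [hin]
  -- A lower bound on the limsup needs only base points `y = v`, where Cauchy–Schwarz gives the
  -- convexity inequality for the norm.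
  refine le_limsup_of_frequently_le ?_ (hlip.locallyLipschitz.isBoundedUnder_quotient v d)
  have hev : ∀ᶠ s : ℝ in 𝓝[>] 0, inner ℝ (D v) (D d) / (2 * ‖D v‖) ≤
      ((1 / 2 : ℝ) * ‖hadamard u (v + s • d)‖ - 1 / 2 * ‖hadamard u v‖) / s := by
    filter_upwards [self_mem_nhdsWithin] with s hs
    have hs0 : 0 < s := hs
    rw [hDx] at hn
    rw [hDx, hDx, le_div_iff₀ hs0, div_mul_eq_mul_div, div_le_iff₀ (by positivity)]
    have h1 := real_inner_le_norm (D v) (D (v + s • d))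
    rw [map_add, map_smul, inner_add_right, real_inner_smul_right, real_inner_self_eq_norm_sq]
      at h1
    rw [map_add, map_smul]
    nlinarith
  have hmap : Tendsto (fun s : ℝ => (v, s)) (𝓝[>] 0) (𝓝 v ×ˢ 𝓝[>] (0 : ℝ)) :=
    (tendsto_const_nhds (x := v)).prodMk tendsto_id
  exact hmap.frequently hev.frequently

end WeightedNorm

section KKT

variable {p N : ℕ} {q : Fin N → Param p → ℝ} {L : ℝ}

/-- A stationarity certificate for homogeneous constraints yields a KKT point on the same ray. -/
theorem exists_isKKTPoint_of_multipliers (hq : ∀ i, LocallyLipschitz (q i)) (hL : 0 < L)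
    (hom : ∀ i, ∀ α : ℝ, 0 < α → ∀ x, q i (α • x) = α ^ L * q i x) {hInf x : Param p}
    (hpos : ∀ j, 0 < hInf j) (hx : x ≠ 0) {μ : Fin N → ℝ} {ζ : Fin N → Param p} {c m : ℝ}
    (hc : 0 < c) (hm : 0 < m) (hμ : ∀ i, 0 ≤ μ i) (hζ : ∀ i, ζ i ∈ clarkeSubdiff (q i) x)
    (hqm : ∀ i, m ≤ q i x) (hcomp : ∀ i, μ i * (q i x - m) = 0)
    (hstat : ∀ j, ∑ i, μ i * ζ i j = c * (x j / hInf j)) :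
    ∃ v, IsKKTPoint (fun x => (1 / 2 : ℝ) * ‖hadamard (hadamardPow hInf (-(1 / 2))) x‖)
      (fun i x => 1 - q i x) v ∧ ∃ b : ℝ, 0 < b ∧ x = b • v := by
  -- Scaling by `β` divides all margins by `m`, so the smallest becomes 1.
  set β := m ^ (-(1 / L)) with hβ
  have hβpos : 0 < β := Real.rpow_pos_of_pos hm _
  have hβL : β ^ L = m⁻¹ := by
    rw [hβ, ← Real.rpow_mul hm.le, ← Real.rpow_neg_one]
    congr 1
    field_simp
  have hqv : ∀ i, q i (β • x) = q i x / m := fun i => by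
    rw [hom i β hβpos, hβL]
    ring
  set u := hadamardPow hInf (-(1 / 2)) with hu
  have husq : ∀ j, u j ^ 2 = (hInf j)⁻¹ := fun j => by
    change (hInf j ^ (-(1 / 2) : ℝ)) ^ 2 = _
    rw [← Real.rpow_natCast, ← Real.rpow_mul (hpos j).le, ← Real.rpow_neg_one]
    norm_num
  have hne : hadamard u (β • x) ≠ 0 := by
    intro h0
    apply hx
    ext j
    have h1 := congrArg (fun y : Param p => y j) h0
    simp only [hadamard, PiLp.smul_apply, smul_eq_mul, PiLp.zero_apply, mul_eq_zero] at h1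
    rcases h1 with h1 | h1 | h1
    · have := husq j
      rw [h1] at this
      have h2 := inv_pos.2 (hpos j)
      norm_num at this
      exact absurd this.symm (hpos j).ne'
    · exact absurd h1 hβpos.ne'
    · simpa using h1
  set n := ‖hadamard u (β • x)‖ with hn
  have hnpos : 0 < n := norm_pos_iff.2 hne
  have hpw : 0 < β ^ (L - 1) := Real.rpow_pos_of_pos hβpos _
  -- The multiplier factor balances the objective's gradient `β x_j / (2 n h_j)` against constraint
  -- gradients scaled by `β ^ (L - 1)`.
  refine ⟨β • x, ⟨fun i => ?_, fun i => β / (2 * n * c * β ^ (L - 1)) * μ i, _,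
    fun i => -(β ^ (L - 1) • ζ i), fun i => mul_nonneg (by positivity) (hμ i),
    mem_clarkeSubdiff_half_norm_hadamard u (β • x) hne,
    fun i => neg_mem_clarkeSubdiff_const_sub (hq i) 1
      (rpow_smul_mem_clarkeSubdiff (hq i) (hom i) (hζ i) hβpos), ?_, fun i => ?_⟩,
    β⁻¹, inv_pos.2 hβpos, ?_⟩
  · have : 1 ≤ q i x / m := (one_le_div hm).2 (hqm i)
    simp only [hqv]
    linarith
  · ext j
    have h1 : ∑ i, (β / (2 * n * c * β ^ (L - 1)) * μ i) * -(β ^ (L - 1) * ζ i j) =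
        -(β / (2 * n * c)) * ∑ i, μ i * ζ i j := by
      rw [Finset.mul_sum]
      refine Finset.sum_congr rfl fun i _ => ?_
      field_simp
    simp only [PiLp.add_apply, WithLp.ofLp_sum, Finset.sum_apply, PiLp.smul_apply, PiLp.neg_apply,
      smul_eq_mul, PiLp.zero_apply, ← hn]
    rw [h1, hstat, husq]
    field_simp
    ring
  · simp only [hqv]
    have h1 : μ i * (1 - q i x / m) = 0 := by
      have : μ i * (1 - q i x / m) = -(μ i * (q i x - m)) / m := by
        field_simp
        ring
      rw [this, hcomp i]
      simp
    rw [mul_assoc, h1, mul_zero]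
  · rw [smul_smul, inv_mul_cancel₀ hβpos.ne', one_smul]

end KKT

namespace IsMarginFlow

variable {p N : ℕ} {ℓ a ψ : ℝ → ℝ} {q : Fin N → Param p → ℝ} {L ε : ℝ} {w g : ℝ → Param p}
  {t₀ : ℝ}

/-- The stationarity information at an aligned regular time, rescaled to the unit sphere. -/
theorem exists_normalized_multipliers (h : IsMarginFlow ℓ a ψ q L ε w g) (h0 : 0 ≤ t₀)
    (hψ : 0 < ψ (lossAlong ℓ q w t₀)) {t κ : ℝ} (ht : t₀ ≤ t) {ξ : Fin N → Param p}
    (hξ : IsRegularTime a q ε w g t ξ)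
    (hal : dissipation ε g t * adaptiveSqNorm ε g w t ≤ κ * weightedMargin a q L w t ^ 2) :
    ∃ (μ : Fin N → ℝ) (ζ : Fin N → Param p), (∀ i, 0 ≤ μ i) ∧ ∑ i, μ i = 1 ∧
      (∀ i, ζ i ∈ clarkeSubdiff (q i) (‖w t‖⁻¹ • w t)) ∧
      (∀ i k, μ i ≤ 2 * Real.exp (q k (w t) - q i (w t))) ∧
      (∑ j, (∑ i, μ i * ζ i j) ^ 2 * adagradConditioner ε g t j) *
          (∑ j, (‖w t‖⁻¹ • w t) j ^ 2 / adagradConditioner ε g t j) ≤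
        κ * (L * ∑ i, μ i * q i (‖w t‖⁻¹ • w t)) ^ 2 := by
  have := h.nonempty
  have hψt := h.inv_loss_pos h0 hψ ht
  have hn : 0 < ‖w t‖ := norm_pos_iff.2 (h.ne_zero hψt)
  have hninv := inv_pos.2 hn
  set A := ∑ i, a (q i (w t)) with hA
  have hApos : 0 < A := Finset.sum_pos (fun i _ => h.loss.slope_pos _) Finset.univ_nonempty
  set s := ‖w t‖⁻¹ ^ (L - 1) with hs
  have hsL : ‖w t‖⁻¹ ^ L = s * ‖w t‖⁻¹ := by
    rw [hs, Real.rpow_sub_one hninv.ne']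
    field_simp
  refine ⟨fun i => a (q i (w t)) / A, fun i => s • ξ i,
    fun i => div_nonneg (h.loss.slope_pos _).le hApos.le, ?_, fun i =>
      rpow_smul_mem_clarkeSubdiff (h.lip i) (h.hom i) (hξ.mem i) hninv, fun i k => ?_, ?_⟩
  · rw [← Finset.sum_div, div_self hApos.ne']
  -- The exponential tail: `a(q i) ≤ e^{-q i}`, while the normaliser is at least `a(q k) ≥ e^{-q k}
  -- / 2`.
  · rw [div_le_iff₀ hApos]
    have h1 : a (q k (w t)) ≤ A :=
      Finset.single_le_sum (f := fun k => a (q k (w t))) (fun k _ => (h.loss.slope_pos _).le)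
        (Finset.mem_univ k)
    have h2 := h.loss.slope_lower _ (h.margin_pos hψt k).le
    calc a (q i (w t)) ≤ Real.exp (-q i (w t)) := h.loss.slope_upper _
      _ = 2 * Real.exp (q k (w t) - q i (w t)) * (Real.exp (-q k (w t)) / 2) := by
        rw [mul_div_assoc', mul_assoc, ← Real.exp_add]
        ring_nf
      _ ≤ 2 * Real.exp (q k (w t) - q i (w t)) * A := by gcongr; linarith
  · have e1 : ∀ j, ∑ i, a (q i (w t)) / A * (s • ξ i) j = -(s / A) * g t j := by
      intro j
      have h1 : g t j = -∑ i, a (q i (w t)) * ξ i j := by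
        conv_lhs => rw [hξ.grad]
        simp
      rw [h1, neg_mul_neg, Finset.mul_sum]
      refine Finset.sum_congr rfl fun i _ => ?_
      simp only [PiLp.smul_apply, smul_eq_mul]
      ring
    have e2 : ∑ j, (∑ i, a (q i (w t)) / A * (s • ξ i) j) ^ 2 * adagradConditioner ε g t j =
        (s / A) ^ 2 * dissipation ε g t := by
      rw [dissipation, Finset.mul_sum]
      refine Finset.sum_congr rfl fun j _ => ?_
      rw [e1]
      change _ * (√(secondMoment ε g j t))⁻¹ = _
      ring
    have e3 : ∑ j, (‖w t‖⁻¹ • w t) j ^ 2 / adagradConditioner ε g t j =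
        ‖w t‖⁻¹ ^ 2 * adaptiveSqNorm ε g w t := by
      rw [adaptiveSqNorm, Finset.mul_sum]
      refine Finset.sum_congr rfl fun j _ => ?_
      change _ / (√(secondMoment ε g j t))⁻¹ = _
      rw [div_inv_eq_mul]
      simp only [PiLp.smul_apply, smul_eq_mul]
      ring
    have e4 : L * ∑ i, a (q i (w t)) / A * q i (‖w t‖⁻¹ • w t) =
        s * ‖w t‖⁻¹ / A * weightedMargin a q L w t := by
      rw [weightedMargin, ← mul_assoc, mul_comm _ L, mul_assoc, Finset.mul_sum (a := _ / A)]
      congr 1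
      refine Finset.sum_congr rfl fun i _ => ?_
      rw [h.hom i _ hninv, hsL]
      ring
    rw [e2, e3, e4]
    have h1 := mul_le_mul_of_nonneg_left hal (sq_nonneg (s * ‖w t‖⁻¹ / A))
    calc _ = (s * ‖w t‖⁻¹ / A) ^ 2 * (dissipation ε g t * adaptiveSqNorm ε g w t) := by ring
      _ ≤ _ := h1
      _ = _ := by ring

/-- Every limit direction carries a stationarity certificate for the limiting conditioner. -/
theorem exists_limit_multipliers (h : IsMarginFlow ℓ a ψ q L ε w g) (h0 : 0 ≤ t₀)
    (hψ : 0 < ψ (lossAlong ℓ q w t₀)) {hInf : Param p}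
    (hlim : Tendsto (adagradConditioner ε g) atTop (𝓝 hInf)) (hpos : ∀ j, 0 < hInf j)
    {wBar : Param p} (hw : MapClusterPt wBar atTop (fun t : ℝ => ‖w t‖⁻¹ • w t)) :
    ∃ (μ : Fin N → ℝ) (ζ : Fin N → Param p) (c m : ℝ), wBar ≠ 0 ∧ 0 < c ∧ 0 < m ∧
      (∀ i, 0 ≤ μ i) ∧ (∀ i, ζ i ∈ clarkeSubdiff (q i) wBar) ∧ (∀ i, m ≤ q i wBar) ∧
      (∀ i, μ i * (q i wBar - m) = 0) ∧
      ∀ j, ∑ i, μ i * ζ i j = c * (wBar j / hInf j) := by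
  have := h.nonempty
  have hη : ∀ k : ℕ, (0 : ℝ) < 1 / (k + 1) := fun k => by positivity
  choose t ht0 htk htw htal ξ hξ using fun k : ℕ =>
    h.exists_aligned_time h0 hψ hw (hη k) (k : ℝ)
  choose μ ζ hμ0 hμ1 hζ htail hal using fun k : ℕ =>
    h.exists_normalized_multipliers h0 hψ (ht0 k) (hξ k) (htal k)
  set x : ℕ → Param p := fun k => ‖w (t k)‖⁻¹ • w (t k) with hx
  have hwn : ∀ k, 0 < ‖w (t k)‖ := fun k =>
    norm_pos_iff.2 (h.ne_zero (h.inv_loss_pos h0 hψ (ht0 k)))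
  have hxn : ∀ k, ‖x k‖ = 1 := fun k => by
    simp [hx, norm_smul, (hwn k).ne']
  have hxlim : Tendsto x atTop (𝓝 wBar) :=
    tendsto_iff_norm_sub_tendsto_zero.2
      (squeeze_zero (fun k => norm_nonneg _) htw tendsto_one_div_add_atTop_nhds_zero_nat)
  have htlim : Tendsto t atTop atTop := tendsto_atTop_mono htk tendsto_natCast_atTop_atTop
  have hwBar : ‖wBar‖ = 1 := by
    refine tendsto_nhds_unique hxlim.norm ?_
    simp [hxn]
  choose K hK0 hK using fun i => exists_norm_clarkeSubdiff_le (h.lip i) (h.hom i)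
  have hbound : ∀ k, (μ k, ζ k) ∈ Metric.closedBall
      (0 : (Fin N → ℝ) × (Fin N → Param p)) (max 1 (∑ i, K i)) := by
    intro k
    rw [mem_closedBall_zero_iff]
    refine max_le_max ?_ ?_
    · refine (pi_norm_le_iff_of_nonneg zero_le_one).2 fun i => ?_
      rw [Real.norm_eq_abs, abs_of_nonneg (hμ0 k i), ← hμ1 k]
      exact Finset.single_le_sum (fun i _ => hμ0 k i) (Finset.mem_univ i)
    · refine (pi_norm_le_iff_of_nonneg (Finset.sum_nonneg fun i _ => hK0 i)).2 fun i => ?_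
      have h1 := hK i (x k) (norm_pos_iff.1 (by rw [hxn]; exact one_pos)) _ (hζ k i)
      rw [hxn, Real.one_rpow, mul_one] at h1
      exact h1.trans (Finset.single_le_sum (fun i _ => hK0 i) (Finset.mem_univ i))
  obtain ⟨⟨μ', ζ'⟩, -, φ, hφ, hconv⟩ := tendsto_subseq_of_bounded Metric.isBounded_closedBall hbound
  have hμlim : ∀ i, Tendsto (fun k => μ (φ k) i) atTop (𝓝 (μ' i)) :=
    tendsto_pi_nhds.1 ((continuous_fst.tendsto _).comp hconv)
  have hζlim : ∀ i, Tendsto (fun k => ζ (φ k) i) atTop (𝓝 (ζ' i)) :=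
    tendsto_pi_nhds.1 ((continuous_snd.tendsto _).comp hconv)
  have hxφ : Tendsto (fun k => x (φ k)) atTop (𝓝 wBar) := hxlim.comp hφ.tendsto_atTop
  have htφ : Tendsto (fun k => t (φ k)) atTop atTop := htlim.comp hφ.tendsto_atTop
  have hqlim : ∀ i, Tendsto (fun k => q i (x (φ k))) atTop (𝓝 (q i wBar)) := fun i =>
    ((h.lip i).continuous.tendsto _).comp hxφ
  have hhlim : ∀ j, Tendsto (fun k => adagradConditioner ε g (t (φ k)) j) atTop (𝓝 (hInf j)) :=
    fun j => ((EuclideanSpace.proj (𝕜 := ℝ) j).continuous.tendsto _).comp (hlim.comp htφ)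
  have hxjlim : ∀ j, Tendsto (fun k => x (φ k) j) atTop (𝓝 (wBar j)) :=
    fun j => ((EuclideanSpace.proj (𝕜 := ℝ) j).continuous.tendsto _).comp hxφ
  have hζjlim : ∀ i j, Tendsto (fun k => ζ (φ k) i j) atTop (𝓝 (ζ' i j)) :=
    fun i j => ((EuclideanSpace.proj (𝕜 := ℝ) j).continuous.tendsto _).comp (hζlim i)
  have hμ'0 : ∀ i, 0 ≤ μ' i := fun i => ge_of_tendsto' (hμlim i) fun k => hμ0 _ i
  have hμ'1 : ∑ i, μ' i = 1 := by
    refine tendsto_nhds_unique (tendsto_finsetSum _ fun i _ => hμlim i) ?_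
    simp [hμ1]
  have hζ' : ∀ i, ζ' i ∈ clarkeSubdiff (q i) wBar := fun i =>
    mem_clarkeSubdiff_of_tendsto (h.lip i) hxφ (hζlim i) (Eventually.of_forall fun k => hζ _ i)
  obtain ⟨c₀, hc₀, hc₀q⟩ := h.exists_mul_rpow_le_margin h0 hψ
  have hqx : ∀ k i, q i (x k) = ‖w (t k)‖⁻¹ ^ L * q i (w (t k)) := fun k i =>
    h.hom i _ (inv_pos.2 (hwn k)) _
  have hqlow : ∀ i, c₀ ≤ q i wBar := fun i => by
    refine ge_of_tendsto' (hqlim i) fun k => ?_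
    rw [hqx, Real.inv_rpow (hwn _).le, le_inv_mul_iff₀ (Real.rpow_pos_of_pos (hwn _) _), mul_comm]
    exact hc₀q _ (ht0 _) i
  obtain ⟨i₀, -, hi₀⟩ := Finset.exists_min_image Finset.univ (fun i => q i wBar)
    Finset.univ_nonempty
  have hm : 0 < q i₀ wBar := hc₀.trans_le (hqlow i₀)
  have hcomp : ∀ i, μ' i * (q i wBar - q i₀ wBar) = 0 := by
    intro i
    rcases (hi₀ i (Finset.mem_univ i)).eq_or_lt with heq | hlt
    · rw [heq, sub_self, mul_zero]
    -- If `q i` exceeds the minimum in the limit, the gap `q i (w) - q i₀ (w)` is asymptotically a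
    -- positive multiple of the diverging `q i₀ (w)`, so the tail bound kills `μ' i`.
    · have h1 : Tendsto (fun k => ψ (lossAlong ℓ q w (t (φ k)))) atTop atTop :=
        (h.tendsto_inv_loss_atTop h0 hψ).comp htφ
      have h2 : Tendsto (fun k => q i₀ (w (t (φ k)))) atTop atTop :=
        tendsto_atTop_mono (fun k => h.loss.inv_le_of_sum (fun i => q i (w (t (φ k)))) i₀) h1
      have h3 : Tendsto (fun k => 1 - q i (x (φ k)) / q i₀ (x (φ k))) atTop
          (𝓝 (1 - q i wBar / q i₀ wBar)) :=
        tendsto_const_nhds.sub ((hqlim i).div (hqlim i₀) hm.ne')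
      have h4 : 1 - q i wBar / q i₀ wBar < 0 := by
        rw [sub_neg, one_lt_div hm]
        exact hlt
      have h5 := h2.atTop_mul_neg h4 h3
      have h6 : Tendsto (fun k => 2 * Real.exp (q i₀ (w (t (φ k))) - q i (w (t (φ k))))) atTop
          (𝓝 (2 * 0)) := by
        refine (Real.tendsto_exp_atBot.comp (h5.congr fun k => ?_)).const_mul 2
        have h7 := h.margin_pos (h.inv_loss_pos h0 hψ (ht0 (φ k))) i₀
        have h8 : 0 < ‖w (t (φ k))‖⁻¹ ^ L := Real.rpow_pos_of_pos (inv_pos.2 (hwn _)) _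
        rw [hqx, hqx, mul_div_mul_left _ _ h8.ne']
        field_simp
      rw [mul_zero] at h6
      have h9 : μ' i ≤ 0 := le_of_tendsto_of_tendsto' (hμlim i) h6 fun k => htail _ i i₀
      rw [le_antisymm h9 (hμ'0 i), zero_mul]
  set Y : Fin p → ℝ := fun j => ∑ i, μ' i * ζ' i j with hY
  set V := L * ∑ i, μ' i * q i wBar with hV
  set P := ∑ j, wBar j ^ 2 / hInf j with hP
  have hVpos : 0 < V := by
    refine mul_pos h.order_pos (hc₀.trans_le ?_)
    calc c₀ = ∑ i, μ' i * c₀ := by rw [← Finset.sum_mul, hμ'1, one_mul]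
      _ ≤ _ := Finset.sum_le_sum fun i _ => mul_le_mul_of_nonneg_left (hqlow i) (hμ'0 i)
  -- The limit of the alignment bounds is the reverse Cauchy–Schwarz inequality for `Y` and `wBar`,
  -- whose pairing is `V` by Euler's identity.
  have hlimit : (∑ j, Y j ^ 2 * hInf j) * P ≤ V ^ 2 := by
    have hl : Tendsto (fun k => (∑ j, (∑ i, μ (φ k) i * ζ (φ k) i j) ^ 2 *
        adagradConditioner ε g (t (φ k)) j) *
          (∑ j, x (φ k) j ^ 2 / adagradConditioner ε g (t (φ k)) j)) atTop
        (𝓝 ((∑ j, Y j ^ 2 * hInf j) * P)) :=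
      (tendsto_finsetSum _ fun j _ => ((tendsto_finsetSum _ fun i _ =>
        (hμlim i).mul (hζjlim i j)).pow 2).mul (hhlim j)).mul
        (tendsto_finsetSum _ fun j _ => ((hxjlim j).pow 2).div (hhlim j) (hpos j).ne')
    have hr1 : Tendsto (fun k => (1 + 1 / ((φ k : ℝ) + 1))) atTop (𝓝 (1 + 0)) :=
      tendsto_const_nhds.add (tendsto_one_div_add_atTop_nhds_zero_nat.comp hφ.tendsto_atTop)
    have hr := hr1.mul (((tendsto_finsetSum Finset.univ fun i _ =>
      (hμlim i).mul (hqlim i)).const_mul L).pow 2)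
    rw [add_zero, one_mul] at hr
    exact le_of_tendsto_of_tendsto' hl hr fun k => hal (φ k)
  have hEuler : ∑ j, Y j * wBar j = V := by
    rw [hV, Finset.mul_sum]
    simp only [hY, Finset.sum_mul]
    rw [Finset.sum_comm]
    refine Finset.sum_congr rfl fun i _ => ?_
    have h1 := inner_eq_of_mem_clarkeSubdiff (h.lip i) (h.chain i) (h.hom i) (hζ' i)
    rw [PiLp.inner_apply] at h1
    simp only [RCLike.inner_apply, conj_trivial] at h1
    calc ∑ j, μ' i * ζ' i j * wBar j = μ' i * ∑ j, wBar j * ζ' i j := by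
          rw [Finset.mul_sum]
          exact Finset.sum_congr rfl fun j _ => by ring
      _ = L * (μ' i * q i wBar) := by
          rw [h1]
          ring
  have hwne : wBar ≠ 0 := norm_pos_iff.1 (by rw [hwBar]; exact one_pos)
  have hPpos : 0 < P := by
    obtain ⟨j, hj⟩ : ∃ j, wBar j ≠ 0 := by
      by_contra! hcon
      exact hwne (by ext j; simpa using hcon j)
    refine Finset.sum_pos' (fun k _ => div_nonneg (sq_nonneg _) (hpos k).le)
      ⟨j, Finset.mem_univ j, div_pos (by positivity) (hpos j)⟩
  refine ⟨μ', ζ', V / P, q i₀ wBar, hwne, div_pos hVpos hPpos, hm, hμ'0, hζ',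
    fun i => hi₀ i (Finset.mem_univ i), hcomp, fun j => ?_⟩
  -- Equality in Cauchy–Schwarz, read off from the weighted square of `Y` minus its projection onto
  -- `wBar / hInf`.
  have hsum : ∑ j, hInf j * (Y j - V / P * (wBar j / hInf j)) ^ 2 =
      ∑ j, Y j ^ 2 * hInf j - V ^ 2 / P := by
    have e1 : ∀ j, hInf j * (Y j - V / P * (wBar j / hInf j)) ^ 2 =
        Y j ^ 2 * hInf j - 2 * (V / P) * (Y j * wBar j) +
          (V / P) ^ 2 * (wBar j ^ 2 / hInf j) := fun j => by
      have := (hpos j).ne'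
      field_simp
      ring
    simp only [e1]
    rw [Finset.sum_add_distrib, Finset.sum_sub_distrib, ← Finset.mul_sum, ← Finset.mul_sum,
      hEuler, ← hP]
    field_simp
    ring
  have hnonpos : ∑ j, hInf j * (Y j - V / P * (wBar j / hInf j)) ^ 2 ≤ 0 := by
    rw [hsum, sub_nonpos, le_div_iff₀ hPpos]
    exact hlimit
  have hterm : ∀ j ∈ Finset.univ, 0 ≤ hInf j * (Y j - V / P * (wBar j / hInf j)) ^ 2 :=
    fun j _ => mul_nonneg (hpos j).le (sq_nonneg _)
  have hz := (Finset.sum_eq_zero_iff_of_nonneg hterm).1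
    (le_antisymm hnonpos (Finset.sum_nonneg hterm)) j (Finset.mem_univ j)
  have hz2 := pow_eq_zero_iff (two_ne_zero) |>.1 ((mul_eq_zero.1 hz).resolve_left (hpos j).ne')
  exact sub_eq_zero.1 hz2

end IsMarginFlow

/-! ### Conclusion for the two losses. -/

theorem empiricalLoss_pos {p N : ℕ} [Nonempty (Fin N)] (f : ℝ → ℝ) (q : Fin N → Param p → ℝ)
    (x : Param p) : 0 < empiricalLoss f q x :=
  Finset.sum_pos (fun _ _ => Real.exp_pos _) Finset.univ_nonempty

end

theorem mainTheorem2 {p N : ℕ}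
    (f : ℝ → ℝ) (hf : f = expLossExponent ∨ f = logisticLossExponent)
    (q : Fin N → Param p → ℝ)
    (hLip : ∀ i, LocallyLipschitz (q i))
    (hChain : ∀ i, AdmitsChainRule (q i))
    (hHom : ∃ L : ℝ, 0 < L ∧ ∀ (α : ℝ), 0 < α → ∀ (i : Fin N) (x : Param p),
      q i (α • x) = α ^ L * q i x)
    (ε : ℝ) (hε : 0 < ε)
    (w g : ℝ → Param p)
    (hflow : IsAdaGradFlow (empiricalLoss f q) ε w g)
    -- separability: `f⁻¹(log (1 / 𝓛(w(t₀)))) > 0` for some time `t₀`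
    (hSep : ∃ t₀ : ℝ, 0 ≤ t₀ ∧ ∃ s : ℝ, 0 < s ∧ f s = Real.log (1 / empiricalLoss f q (w t₀))) :
    ∃ hInf : Param p,
      Tendsto (adagradConditioner ε g) atTop (𝓝 hInf) ∧ (∀ j, 0 < hInf j) ∧
      ∀ wBar : Param p, MapClusterPt wBar atTop (fun t : ℝ => ‖w t‖⁻¹ • w t) →
        ∃ v : Param p,
          IsKKTPoint (fun x => (1 / 2 : ℝ) * ‖hadamard (hadamardPow hInf (-(1 / 2))) x‖)
            (fun i x => 1 - q i x) v ∧
          ∃ c : ℝ, 0 < c ∧ wBar = c • v := by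
  obtain ⟨L, hL, hom⟩ := hHom
  obtain ⟨t₀, h0, s, hs, hfs⟩ := hSep
  obtain ⟨a, ψ, hloss⟩ := exists_isExpTailLoss hf
  have hne : Nonempty (Fin N) := by
    -- With no samples the loss is 0; the conventions `1 / 0 = 0` and `log 0 = 0` turn the
    -- separability condition into `f s = 0`, impossible for `s > 0`.
    rcases N.eq_zero_or_pos with rfl | hN
    · have := lossExponent_pos hf hs
      rw [hfs] at this
      simp [empiricalLoss] at this
    · exact ⟨⟨0, hN⟩⟩
  have h : IsMarginFlow (fun x => Real.exp (-f x)) a ψ q L ε w g :=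
    ⟨hne, hloss, hLip, hChain, hL, fun i α hα x => hom α hα i x, hε, hflow⟩
  have hψ : 0 < ψ (lossAlong (fun x => Real.exp (-f x)) q w t₀) := by
    have h1 : lossAlong (fun x => Real.exp (-f x)) q w t₀ = Real.exp (-f s) := by
      rw [hfs, one_div, Real.log_inv, neg_neg, Real.exp_log (empiricalLoss_pos f q (w t₀))]
      rfl
    rw [h1, hloss.left_inv s]
    exact hs
  obtain ⟨hInf, hlim, hpos⟩ := h.exists_tendsto_adagradConditioner
  refine ⟨hInf, hlim, hpos, fun wBar hw => ?_⟩
  obtain ⟨μ, ζ, c, m, hwne, hc, hm, hμ, hζ, hqm, hcomp, hstat⟩ :=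
    h.exists_limit_multipliers h0 hψ hlim hpos hw
  exact exists_isKKTPoint_of_multipliers hLip hL h.hom hpos hwne hc hm hμ hζ hqm hcomp hstat
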